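/- **Conventions.** An exact category is an additive category $\mathcal F$ with a class $\mathcal S$ of admissible short exact sequences (Quillen's axioms); it is Frobenius if every object receives an admissible epimorphism from a projective and admits an admissible monomorphism into an injective, and projectives and injectives coincide. Its stable category $\underline{\mathcal F}=\mathcal F/\mathrm{proj}(\mathcal S)$ (morphisms modulo those factoring through a projective-injective) is triangulated: $\Sigma X$ is the cokernel of an injective preenvelope $X\to I(X)$, and the distinguished triangles are those isomorphic to the image triangle $M'\to M\to M''\to\Sigma M'$ of an admissible sequence $M'\rightarrowtail M\twoheadrightarrow M''$, where $M''\to\Sigma M'$ is induced by an extension $M\to I(M')$ of the preenvelope $M'\to I(M')$. A triangulated category is algebraic if it is triangle-equivalent to the stable category of a Frobenius exact category. Let $\mathcal K$ be a triangulated category. For a class $\mathcal E$ of distinguished triangles $X\xrightarrow{f}Y\xrightarrow{g}Z\xrightarrow{h}\Sigma X$, the maps $f$ (resp. $g$) that occur are called $\mathcal E$-monomorphisms (resp. $\mathcal E$-epimorphisms). The class $\mathcal E$ is *proper* if it is closed under isomorphisms, suspension and desuspension of triangles, finite direct sums and retracts; contains the triangles $X\xrightarrow{1}X\to0\to\Sigma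 X$ and $0\to Y\xrightarrow{1}Y\to 0$; $\mathcal E$-monomorphisms are closed under homotopy pushouts and $\mathcal E$-epimorphisms under homotopy pullbacks; and $\mathcal E$ is saturated: if the homotopy pullback of a map $g$ along an $\mathcal E$-epimorphism is an $\mathcal E$-epimorphism, then so is $g$. An object $P$ is $\mathcal E$-projective if $0\to\mathcal K(P,X)\to\mathcal K(P,Y)\to\mathcal K(P,Z)\to0$ is exact for every triangle in $\mathcal E$; $\mathcal E$-injectives are defined dually. A proper class $\mathcal E$ is *Frobenius* if every object $X$ admits an $\mathcal E$-epimorphism $P\to X$ with $P$ $\mathcal E$-projective and an $\mathcal E$-monomorphism $X\to J$ with $J$ $\mathcal E$-injective, and the $\mathcal E$-projectives and the $\mathcal E$-injectives coincide. The relative stable category is then the additive quotient $\mathcal K/\mathcal E:=\mathcal K/\mathrm{proj}(\mathcal E)$. Its suspension sends $X$ to the cofibre $\Sigma_{\mathcal E}X$ in $\mathcal K$ of an $\mathcal E$-injective preenvelope $X\to X_{\mathcal E}$. For $f\colon X\to Y$ in $\mathcal K$, with homotopy pushout $Z$ of $f$ and $X\to X_{\mathcal E}$, completing the square to a morphism from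 the triangle $X\to X_{\mathcal E}\to\Sigma_{\mathcal E}X\to\Sigma X$ to a distinguished triangle $Y\to Z\to\Sigma_{\mathcal E}X\to\Sigma Y$ that is the identity on $\Sigma_{\mathcal E}X$ gives a triangle $X\to Y\to Z\to\Sigma_{\mathcal E}X$ in $\mathcal K/\mathcal E$; the distinguished triangles of $\mathcal K/\mathcal E$ are those isomorphic to one of these. **Theorem.** (1) Let $\mathcal F$ be a Frobenius exact category with class of admissible sequences $\mathcal S$, let $\varpi\colon\mathcal F\to\mathcal K=\underline{\mathcal F}$ be the quotient functor to its stable category, and let $\mathcal E$ be a Frobenius class of triangles in $\mathcal K$ with quotient functor $\pi\colon\mathcal K\to\mathcal K/\mathcal E$. Let $\mathcal S_{\mathcal E}\subseteq\mathcal S$ be the class of those admissible sequences whose image triangle in $\mathcal K$ belongs to $\mathcal E$. Then $\mathcal S_{\mathcal E}$ is a Frobenius exact structure on $\mathcal F$. An object $Q$ of $\mathcal F$ is $\mathcal S_{\mathcal E}$-projective if and only if $\varpi Q$ is $\mathcal E$-projective, and $\mathcal S_{\mathcal E}$-injective if and only if $\varpi Q$ is $\mathcal E$-injective. Moreover, with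 $\varpi'\colon\mathcal F\to\mathcal F/\mathrm{proj}(\mathcal S_{\mathcal E})$ the quotient functor, there is an equivalence of triangulated categories $\Phi\colon\mathcal F/\mathrm{proj}(\mathcal S_{\mathcal E})\to\mathcal K/\mathcal E$ with $\Phi\circ\varpi'\cong\pi\circ\varpi$. (2) If $\mathcal K$ is an algebraic triangulated category and $\mathcal E$ is a Frobenius class of triangles in $\mathcal K$, then the relative stable category $\mathcal K/\mathcal E$ is algebraic. -/

import Mathlib

open CategoryTheory Limits

set_option linter.unusedSectionVars false
set_option linter.unusedVariables false

universe v u v' u'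

namespace RelStable

/-! ## Additive quotients -/

section AddQuotient

variable {C : Type u} [Category.{v} C] [Preadditive C]

/-- `f` factors through an object satisfying `P`. -/
def FactorsThrough (P : ObjectProperty C) {X Y : C} (f : X ⟶ Y) : Prop :=
  ∃ (Z : C) (_ : P Z) (a : X ⟶ Z) (b : Z ⟶ Y), f = a ≫ b

/-- Two parallel morphisms are identified when their difference factors through `P`. -/
def factorRel (P : ObjectProperty C) : HomRel C := fun _ _ f g => FactorsThrough P (f - g)

/-- The additive quotient `C / P`: the same objects, and morphisms modulo those which factor
through an object satisfying `P`. -/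
abbrev AddQuotient (P : ObjectProperty C) := Quotient (factorRel P)

/-- The quotient functor `C ⥤ C / P`. -/
abbrev toAddQuotient (P : ObjectProperty C) : C ⥤ AddQuotient P := Quotient.functor (factorRel P)

/-- `P` holds for some zero object, and is closed under binary direct sums (in particular the
morphisms which factor through `P` form an ideal). -/
class IsSumClosed [HasBinaryBiproducts C] (P : ObjectProperty C) : Prop where
  zero : ∃ Z : C, IsZero Z ∧ P Z
  sum : ∀ X Y : C, P X → P Y → P (X ⊞ Y)

namespace FactorsThrough

variable {P : ObjectProperty C}

lemma precomp {X Y W : C} {f : X ⟶ Y} (h : FactorsThrough P f) (g : W ⟶ X) :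
    FactorsThrough P (g ≫ f) := by
  obtain ⟨Z, hZ, a, b, rfl⟩ := h
  exact ⟨Z, hZ, g ≫ a, b, by simp⟩

lemma postcomp {X Y W : C} {f : X ⟶ Y} (h : FactorsThrough P f) (g : Y ⟶ W) :
    FactorsThrough P (f ≫ g) := by
  obtain ⟨Z, hZ, a, b, rfl⟩ := h
  exact ⟨Z, hZ, a, b ≫ g, by simp⟩

lemma neg {X Y : C} {f : X ⟶ Y} (h : FactorsThrough P f) : FactorsThrough P (-f) := by
  obtain ⟨Z, hZ, a, b, rfl⟩ := h
  exact ⟨Z, hZ, -a, b, by simp⟩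

variable [HasBinaryBiproducts C] [IsSumClosed P]

lemma zero (X Y : C) : FactorsThrough P (0 : X ⟶ Y) := by
  obtain ⟨Z, -, hZ⟩ := IsSumClosed.zero (P := P)
  exact ⟨Z, hZ, 0, 0, by simp⟩

lemma add {X Y : C} {f g : X ⟶ Y} (hf : FactorsThrough P f) (hg : FactorsThrough P g) :
    FactorsThrough P (f + g) := by
  obtain ⟨Z, hZ, a, b, rfl⟩ := hf
  obtain ⟨W, hW, c, d, rfl⟩ := hg
  exact ⟨Z ⊞ W, IsSumClosed.sum _ _ hZ hW, biprod.lift a c, biprod.desc b d, by simp⟩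

end FactorsThrough

section

variable [HasBinaryBiproducts C] (P : ObjectProperty C) [IsSumClosed P]

instance : Congruence (factorRel P) where
  comp_left := by
    intro X Y Z f g g' h
    have := FactorsThrough.precomp h f
    rwa [Preadditive.comp_sub] at this
  comp_right := by
    intro X Y Z f f' g h
    have := FactorsThrough.postcomp h g
    rwa [Preadditive.sub_comp] at this
  equivalence :=
    { refl := fun f => by simpa [factorRel] using FactorsThrough.zero _ _
      symm := fun h => by simpa [factorRel] using FactorsThrough.neg h
      trans := fun h h' => by simpa [factorRel] using FactorsThrough.add h h' }

instance : Preadditive (AddQuotient P) :=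
  Quotient.preadditive (factorRel P) (by
    intro X Y f₁ f₂ g₁ g₂ h h'
    have := FactorsThrough.add h h'
    rw [factorRel]
    convert this using 1
    abel)

instance : (toAddQuotient P).Additive where
  map_add := rfl

lemma map_eq_iff {X Y : C} (f g : X ⟶ Y) :
    (toAddQuotient P).map f = (toAddQuotient P).map g ↔ FactorsThrough P (f - g) :=
  Quotient.functor_map_eq_iff _ _ _

lemma map_eq_zero_iff {X Y : C} (f : X ⟶ Y) :
    (toAddQuotient P).map f = 0 ↔ FactorsThrough P f := by
  rw [← (toAddQuotient P).map_zero, map_eq_iff, sub_zero]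

instance : HasBinaryBiproducts (AddQuotient P) where
  has_binary_biproduct := by
    rintro ⟨X⟩ ⟨Y⟩
    have := preservesBinaryBiproducts_of_preservesBiproducts (toAddQuotient P)
    exact HasBinaryBiproduct.mk
      { bicone := (toAddQuotient P).mapBinaryBicone (BinaryBiproduct.bicone X Y)
        isBilimit := isBinaryBilimitOfPreserves _ (BinaryBiproduct.isBilimit X Y) }

instance [HasZeroObject C] : HasZeroObject (AddQuotient P) :=
  (toAddQuotient P).hasZeroObject_of_additive

end

end AddQuotient

/-! ## Categories with a suspension and distinguished triangles -/

section Triangles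

variable {C : Type u} [Category.{v} C]

/-- A triangle `X ⟶ Y ⟶ Z ⟶ Σ X` for an endofunctor `Σ`. -/
structure Tri (S : C ⥤ C) where
  {X Y Z : C}
  f : X ⟶ Y
  g : Y ⟶ Z
  h : Z ⟶ S.obj X

namespace Tri

variable {S : C ⥤ C}

/-- A morphism of triangles. -/
@[ext]
structure Hom (T T' : Tri S) where
  a : T.X ⟶ T'.X
  b : T.Y ⟶ T'.Y
  c : T.Z ⟶ T'.Z
  comm₁ : T.f ≫ b = a ≫ T'.f
  comm₂ : T.g ≫ c = b ≫ T'.g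
  comm₃ : T.h ≫ S.map a = c ≫ T'.h

instance : Category (Tri S) where
  Hom := Hom
  id T := ⟨𝟙 _, 𝟙 _, 𝟙 _, by simp, by simp, by simp⟩
  comp φ ψ := ⟨φ.a ≫ ψ.a, φ.b ≫ ψ.b, φ.c ≫ ψ.c,
    by rw [← Category.assoc, φ.comm₁, Category.assoc, ψ.comm₁, Category.assoc],
    by rw [← Category.assoc, φ.comm₂, Category.assoc, ψ.comm₂, Category.assoc],
    by rw [S.map_comp, ← Category.assoc, φ.comm₃, Category.assoc, ψ.comm₃, Category.assoc]⟩
  id_comp φ := by apply Hom.ext <;> simp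
  comp_id φ := by apply Hom.ext <;> simp
  assoc φ ψ χ := by apply Hom.ext <;> simp

@[simp] lemma id_a (T : Tri S) : (𝟙 T : T ⟶ T).a = 𝟙 T.X := rfl
@[simp] lemma id_b (T : Tri S) : (𝟙 T : T ⟶ T).b = 𝟙 T.Y := rfl
@[simp] lemma id_c (T : Tri S) : (𝟙 T : T ⟶ T).c = 𝟙 T.Z := rfl
@[simp] lemma comp_a {T T' T'' : Tri S} (φ : T ⟶ T') (ψ : T' ⟶ T'') :
    (φ ≫ ψ).a = φ.a ≫ ψ.a := rfl
@[simp] lemma comp_b {T T' T'' : Tri S} (φ : T ⟶ T') (ψ : T' ⟶ T'') :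
    (φ ≫ ψ).b = φ.b ≫ ψ.b := rfl
@[simp] lemma comp_c {T T' T'' : Tri S} (φ : T ⟶ T') (ψ : T' ⟶ T'') :
    (φ ≫ ψ).c = φ.c ≫ ψ.c := rfl

section Transport

variable {T T' T₀ T₀' : Tri S}

@[simp] lemma hom_inv_a (e : T ≅ T') : e.hom.a ≫ e.inv.a = 𝟙 _ := congr_arg Hom.a e.hom_inv_id
@[simp] lemma hom_inv_b (e : T ≅ T') : e.hom.b ≫ e.inv.b = 𝟙 _ := congr_arg Hom.b e.hom_inv_id
@[simp] lemma hom_inv_c (e : T ≅ T') : e.hom.c ≫ e.inv.c = 𝟙 _ := congr_arg Hom.c e.hom_inv_id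
@[simp] lemma inv_hom_a (e : T ≅ T') : e.inv.a ≫ e.hom.a = 𝟙 _ := congr_arg Hom.a e.inv_hom_id
@[simp] lemma inv_hom_b (e : T ≅ T') : e.inv.b ≫ e.hom.b = 𝟙 _ := congr_arg Hom.b e.inv_hom_id
@[simp] lemma inv_hom_c (e : T ≅ T') : e.inv.c ≫ e.hom.c = 𝟙 _ := congr_arg Hom.c e.inv_hom_id

lemma f_eq (e : T₀ ≅ T) : T.f = e.inv.a ≫ T₀.f ≫ e.hom.b := by
  rw [e.hom.comm₁, ← Category.assoc, inv_hom_a, Category.id_comp]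

lemma g_eq (e : T₀ ≅ T) : T.g = e.inv.b ≫ T₀.g ≫ e.hom.c := by
  rw [e.hom.comm₂, ← Category.assoc, inv_hom_b, Category.id_comp]

lemma h_eq (e : T₀ ≅ T) : T.h = e.inv.c ≫ T₀.h ≫ S.map e.hom.a := by
  rw [e.hom.comm₃, ← Category.assoc, inv_hom_c, Category.id_comp]

lemma fill_of_iso {T T' T₀ T₀' : Tri S} (e : T₀ ≅ T) (e' : T₀' ≅ T')
    (H : ∀ (a : T₀.X ⟶ T₀'.X) (b : T₀.Y ⟶ T₀'.Y), T₀.f ≫ b = a ≫ T₀'.f →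
      ∃ c : T₀.Z ⟶ T₀'.Z, T₀.g ≫ c = b ≫ T₀'.g ∧ T₀.h ≫ S.map a = c ≫ T₀'.h)
    (a : T.X ⟶ T'.X) (b : T.Y ⟶ T'.Y) (comm : T.f ≫ b = a ≫ T'.f) :
    ∃ c : T.Z ⟶ T'.Z, T.g ≫ c = b ≫ T'.g ∧ T.h ≫ S.map a = c ≫ T'.h := by
  obtain ⟨c, h₁, h₂⟩ := H (e.hom.a ≫ a ≫ e'.inv.a) (e.hom.b ≫ b ≫ e'.inv.b) (by
    rw [← Category.assoc, e.hom.comm₁, Category.assoc, reassoc_of% comm, e'.inv.comm₁]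
    simp only [Category.assoc])
  refine ⟨e.inv.c ≫ c ≫ e'.hom.c, ?_, ?_⟩
  · rw [← Category.assoc, e.inv.comm₂, Category.assoc, reassoc_of% h₁, g_eq e']
    simp only [← Category.assoc, inv_hom_b, Category.id_comp]
  · simp only [Category.assoc]
    rw [← e'.hom.comm₃, ← reassoc_of% h₂, h_eq e]
    simp only [Category.assoc, ← S.map_comp, inv_hom_a, Category.comp_id]

end Transport

section Transport

variable [Preadditive C] {T₀ : Tri S}

lemma comp₁₂_of_iso {T : Tri S} (e : T₀ ≅ T) (H : T₀.f ≫ T₀.g = 0) : T.f ≫ T.g = 0 := by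
  rw [f_eq e, Category.assoc, Category.assoc, ← e.hom.comm₂, reassoc_of% H]
  simp

lemma comp₂₃_of_iso {T : Tri S} (e : T₀ ≅ T) (H : T₀.g ≫ T₀.h = 0) : T.g ≫ T.h = 0 := by
  rw [g_eq e, Category.assoc, Category.assoc, ← e.hom.comm₃, reassoc_of% H]
  simp

lemma comp₃₁_of_iso {T : Tri S} (e : T₀ ≅ T) (H : T₀.h ≫ S.map T₀.f = 0) :
    T.h ≫ S.map T.f = 0 := by
  rw [h_eq e, Category.assoc, Category.assoc, ← S.map_comp, ← e.hom.comm₁, S.map_comp,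
    reassoc_of% H]
  simp

lemma desc₂_of_iso {T : Tri S} (e : T₀ ≅ T) {W : C}
    (H : ∀ u : T₀.Y ⟶ W, T₀.f ≫ u = 0 → ∃ v : T₀.Z ⟶ W, u = T₀.g ≫ v)
    (u : T.Y ⟶ W) (hu : T.f ≫ u = 0) : ∃ v : T.Z ⟶ W, u = T.g ≫ v := by
  obtain ⟨v, hv⟩ := H (e.hom.b ≫ u) (by
    rw [← Category.assoc, e.hom.comm₁, Category.assoc, hu, comp_zero])
  refine ⟨e.inv.c ≫ v, ?_⟩
  rw [← Category.assoc, e.inv.comm₂, Category.assoc, ← hv, ← Category.assoc, inv_hom_b,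
    Category.id_comp]

lemma desc₃_of_iso {T : Tri S} (e : T₀ ≅ T) {W : C}
    (H : ∀ u : T₀.Z ⟶ W, T₀.g ≫ u = 0 → ∃ v : S.obj T₀.X ⟶ W, u = T₀.h ≫ v)
    (u : T.Z ⟶ W) (hu : T.g ≫ u = 0) : ∃ v : S.obj T.X ⟶ W, u = T.h ≫ v := by
  obtain ⟨v, hv⟩ := H (e.hom.c ≫ u) (by
    rw [← Category.assoc, e.hom.comm₂, Category.assoc, hu, comp_zero])
  refine ⟨S.map e.inv.a ≫ v, ?_⟩
  rw [← Category.assoc, e.inv.comm₃, Category.assoc, ← hv, ← Category.assoc, inv_hom_c,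
    Category.id_comp]

lemma lift₃_of_iso {T : Tri S} (e : T₀ ≅ T) {W : C}
    (H : ∀ u : W ⟶ T₀.Z, u ≫ T₀.h = 0 → ∃ v : W ⟶ T₀.Y, u = v ≫ T₀.g)
    (u : W ⟶ T.Z) (hu : u ≫ T.h = 0) : ∃ v : W ⟶ T.Y, u = v ≫ T.g := by
  obtain ⟨v, hv⟩ := H (u ≫ e.inv.c) (by
    rw [Category.assoc, ← e.inv.comm₃, reassoc_of% hu, zero_comp])
  refine ⟨v ≫ e.hom.b, ?_⟩
  rw [Category.assoc, ← e.hom.comm₂, ← reassoc_of% hv, inv_hom_c, Category.comp_id]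

end Transport

section

variable [Preadditive C]

/-- The suspension of a triangle (its triple rotation): all three maps are suspended and change
sign. -/
def suspend (T : Tri S) : Tri S := ⟨-S.map T.f, -S.map T.g, -S.map T.h⟩

/-- `T` is a direct sum of the triangles `T₁` and `T₂`. -/
def IsDirectSum (T T₁ T₂ : Tri S) : Prop :=
  ∃ (i₁ : T₁ ⟶ T) (i₂ : T₂ ⟶ T) (p₁ : T ⟶ T₁) (p₂ : T ⟶ T₂),
    i₁ ≫ p₁ = 𝟙 T₁ ∧ i₂ ≫ p₂ = 𝟙 T₂ ∧
    p₁.a ≫ i₁.a + p₂.a ≫ i₂.a = 𝟙 T.X ∧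
    p₁.b ≫ i₁.b + p₂.b ≫ i₂.b = 𝟙 T.Y ∧
    p₁.c ≫ i₁.c + p₂.c ≫ i₂.c = 𝟙 T.Z

end

/-- The image of a triangle under a functor which commutes with the suspensions. -/
def map {C' : Type u'} [Category.{v'} C'] {S' : C' ⥤ C'} (F : C ⥤ C') (θ : S ⋙ F ≅ F ⋙ S')
    (T : Tri S) : Tri S' :=
  ⟨F.map T.f, F.map T.g, F.map T.h ≫ θ.hom.app T.X⟩

end Tri

/-- A suspension functor on `C` and a class of distinguished triangles. It is only used for three
triangulations, all constructed below: those of Mathlib's pretriangulated categories, of the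
stable category of a Frobenius exact category, and of a relative stable category. -/
structure TriangleData (C : Type u) [Category.{v} C] where
  susp : C ⥤ C
  dist : Tri susp → Prop

/-- An equivalence of triangulated categories: an equivalence of categories, with a natural
isomorphism of commutation with the suspensions, that preserves and detects distinguished
triangles. -/
structure TriangleEquiv {C : Type u} [Category.{v} C] {C' : Type u'} [Category.{v'} C']
    (D : TriangleData C) (D' : TriangleData C') where
  functor : C ⥤ C'
  isEquivalence : functor.IsEquivalence
  commSusp : D.susp ⋙ functor ≅ functor ⋙ D'.susp
  dist_iff : ∀ T : Tri D.susp, D.dist T ↔ D'.dist (T.map functor commSusp)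

/-- Those elementary consequences of the axioms of a triangulated category which are needed in
order to construct the suspension of a relative stable category. They are proved below for
Mathlib's pretriangulated categories and for the stable category of a Frobenius category. -/
class TriangleData.IsHomExact [Preadditive C] (D : TriangleData C) : Prop where
  additive : D.susp.Additive
  comp₁₂ : ∀ T, D.dist T → T.f ≫ T.g = 0
  comp₂₃ : ∀ T, D.dist T → T.g ≫ T.h = 0
  comp₃₁ : ∀ T, D.dist T → T.h ≫ D.susp.map T.f = 0
  fill : ∀ T T', D.dist T → D.dist T' → ∀ (a : T.X ⟶ T'.X) (b : T.Y ⟶ T'.Y),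
    T.f ≫ b = a ≫ T'.f → ∃ c : T.Z ⟶ T'.Z, T.g ≫ c = b ≫ T'.g ∧ T.h ≫ D.susp.map a = c ≫ T'.h
  desc₂ : ∀ T, D.dist T → ∀ {W : C} (u : T.Y ⟶ W), T.f ≫ u = 0 → ∃ v : T.Z ⟶ W, u = T.g ≫ v
  desc₃ : ∀ T, D.dist T → ∀ {W : C} (u : T.Z ⟶ W), T.g ≫ u = 0 →
    ∃ v : D.susp.obj T.X ⟶ W, u = T.h ≫ v
  lift₃ : ∀ T, D.dist T → ∀ {W : C} (u : W ⟶ T.Z), u ≫ T.h = 0 → ∃ v : W ⟶ T.Y, u = v ≫ T.g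

section Pretriangulated

open Pretriangulated

variable (K : Type u) [Category.{v} K] [Preadditive K] [HasZeroObject K] [HasShift K ℤ]
  [∀ n : ℤ, (shiftFunctor K n).Additive] [Pretriangulated K]

/-- The suspension and the distinguished triangles of a (pre)triangulated category. -/
def ofPretriangulated : TriangleData K where
  susp := shiftFunctor K (1 : ℤ)
  dist T := Triangle.mk T.f T.g T.h ∈ distTriang K

instance : (ofPretriangulated K).IsHomExact where
  additive := inferInstanceAs (shiftFunctor K (1 : ℤ)).Additive
  comp₁₂ T hT := comp_distTriang_mor_zero₁₂ _ hT
  comp₂₃ T hT := comp_distTriang_mor_zero₂₃ _ hT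
  comp₃₁ T hT := comp_distTriang_mor_zero₃₁ _ hT
  fill T T' hT hT' a b comm := complete_distinguished_triangle_morphism _ _ hT hT' a b comm
  desc₂ T hT W u hu := Triangle.yoneda_exact₂ _ hT u hu
  desc₃ T hT W u hu := Triangle.yoneda_exact₃ _ hT u hu
  lift₃ T hT W u hu := Triangle.coyoneda_exact₃ _ hT u hu

end Pretriangulated

end Triangles

/-! ## Exact categories, Frobenius categories and their stable categories -/

section Exact

variable (F : Type u) [Category.{v} F] [Preadditive F] [HasZeroObject F] [HasBinaryBiproducts F]

/-- An exact structure (in the sense of Quillen) on an additive category, given by its class of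
admissible short exact sequences, here called conflations. The maps `i` and `p` of a conflation
`i, p` are the admissible monomorphisms and the admissible epimorphisms. -/
structure ExactStructure where
  conflation : ShortComplex F → Prop
  of_iso : ∀ {T T' : ShortComplex F}, (T ≅ T') → conflation T → conflation T'
  of_splitting : ∀ T : ShortComplex F, T.Splitting → conflation T
  kernel : ∀ T, conflation T → Nonempty (IsLimit (KernelFork.ofι T.f T.zero))
  cokernel : ∀ T, conflation T → Nonempty (IsColimit (CokernelCofork.ofπ T.g T.zero))
  mono_comp : ∀ {X Y Z : F} (i : X ⟶ Y) (j : Y ⟶ Z),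
    (∃ (W : F) (p : Y ⟶ W) (w : i ≫ p = 0), conflation ⟨i, p, w⟩) →
    (∃ (W : F) (p : Z ⟶ W) (w : j ≫ p = 0), conflation ⟨j, p, w⟩) →
    ∃ (W : F) (p : Z ⟶ W) (w : (i ≫ j) ≫ p = 0), conflation ⟨i ≫ j, p, w⟩
  epi_comp : ∀ {X Y Z : F} (p : X ⟶ Y) (q : Y ⟶ Z),
    (∃ (W : F) (i : W ⟶ X) (w : i ≫ p = 0), conflation ⟨i, p, w⟩) →
    (∃ (W : F) (i : W ⟶ Y) (w : i ≫ q = 0), conflation ⟨i, q, w⟩) →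
    ∃ (W : F) (i : W ⟶ X) (w : i ≫ p ≫ q = 0), conflation ⟨i, p ≫ q, w⟩
  pushout : ∀ {X Y X' : F} (i : X ⟶ Y) (a : X ⟶ X'),
    (∃ (W : F) (p : Y ⟶ W) (w : i ≫ p = 0), conflation ⟨i, p, w⟩) →
    ∃ (Y' : F) (b : Y ⟶ Y') (i' : X' ⟶ Y'), IsPushout i a b i' ∧
      ∃ (W : F) (p : Y' ⟶ W) (w : i' ≫ p = 0), conflation ⟨i', p, w⟩
  pullback : ∀ {Y Z Z' : F} (p : Y ⟶ Z) (a : Z' ⟶ Z),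
    (∃ (W : F) (i : W ⟶ Y) (w : i ≫ p = 0), conflation ⟨i, p, w⟩) →
    ∃ (Y' : F) (b : Y' ⟶ Y) (p' : Y' ⟶ Z'), IsPullback b p' p a ∧
      ∃ (W : F) (i : W ⟶ Y') (w : i ≫ p' = 0), conflation ⟨i, p', w⟩

variable {F}

namespace ExactStructure

variable (S : ExactStructure F)

/-- Admissible monomorphisms. -/
def IsAdmissibleMono {X Y : F} (i : X ⟶ Y) : Prop :=
  ∃ (W : F) (p : Y ⟶ W) (w : i ≫ p = 0), S.conflation ⟨i, p, w⟩

/-- Admissible epimorphisms. -/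
def IsAdmissibleEpi {Y Z : F} (p : Y ⟶ Z) : Prop :=
  ∃ (W : F) (i : W ⟶ Y) (w : i ≫ p = 0), S.conflation ⟨i, p, w⟩

/-- Projective objects, relative to the admissible sequences. -/
def IsProjective : ObjectProperty F := fun Q =>
  ∀ T : ShortComplex F, S.conflation T → ∀ f : Q ⟶ T.X₃, ∃ f' : Q ⟶ T.X₂, f' ≫ T.g = f

/-- Injective objects, relative to the admissible sequences. -/
def IsInjective : ObjectProperty F := fun Q =>
  ∀ T : ShortComplex F, S.conflation T → ∀ f : T.X₁ ⟶ Q, ∃ f' : T.X₂ ⟶ Q, T.f ≫ f' = f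

/-- Frobenius exact structures. -/
structure IsFrobenius : Prop where
  enough_projectives : ∀ X : F, ∃ (Q : F) (p : Q ⟶ X), S.IsProjective Q ∧ S.IsAdmissibleEpi p
  enough_injectives : ∀ X : F, ∃ (J : F) (i : X ⟶ J), S.IsInjective J ∧ S.IsAdmissibleMono i
  projective_iff_injective : ∀ X : F, S.IsProjective X ↔ S.IsInjective X

instance : IsSumClosed S.IsProjective where
  zero := by
    obtain ⟨Z, hZ⟩ := HasZeroObject.zero (C := F)
    exact ⟨Z, hZ, fun T _ f => ⟨0, hZ.eq_of_src _ _⟩⟩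
  sum := fun X Y hX hY T hT f => by
    obtain ⟨a, ha⟩ := hX T hT (biprod.inl ≫ f)
    obtain ⟨b, hb⟩ := hY T hT (biprod.inr ≫ f)
    exact ⟨biprod.desc a b, by ext <;> simp [ha, hb]⟩

/-- The stable category: the additive quotient of `F` by the projective objects (which for
Frobenius exact structures are the projective-injective objects). -/
abbrev Stable := AddQuotient S.IsProjective

/-- The quotient functor to the stable category. -/
abbrev toStable : F ⥤ S.Stable := toAddQuotient S.IsProjective

variable {S}

section

variable {T : ShortComplex F}

lemma epi_g (hT : S.conflation T) : Epi T.g := ⟨fun _ _ h => Cofork.IsColimit.hom_ext (S.cokernel T hT).some h⟩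

lemma exists_desc (hT : S.conflation T) {W : F} (u : T.X₂ ⟶ W) (hu : T.f ≫ u = 0) : ∃ v, T.g ≫ v = u :=
  ⟨_, (CokernelCofork.IsColimit.desc' (S.cokernel T hT).some u hu).2⟩

lemma exists_lift (hT : S.conflation T) {W : F} (u : W ⟶ T.X₂) (hu : u ≫ T.g = 0) : ∃ v, v ≫ T.f = u :=
  ⟨_, (KernelFork.IsLimit.lift' (S.kernel T hT).some u hu).2⟩

end

namespace IsFrobenius

variable (hS : S.IsFrobenius)

/-- The target of the chosen injective preenvelope of `X`. -/
noncomputable def hull (X : F) : F := (hS.enough_injectives X).choose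

/-- The chosen injective preenvelope of `X`. -/
noncomputable def ι (X : F) : X ⟶ hS.hull X := (hS.enough_injectives X).choose_spec.choose

lemma hull_injective (X : F) : S.IsInjective (hS.hull X) :=
  (hS.enough_injectives X).choose_spec.choose_spec.1

lemma hull_projective (X : F) : S.IsProjective (hS.hull X) :=
  (hS.projective_iff_injective _).2 (hS.hull_injective X)

lemma ι_mono (X : F) : S.IsAdmissibleMono (hS.ι X) :=
  (hS.enough_injectives X).choose_spec.choose_spec.2

/-- The cokernel of the chosen injective preenvelope of `X`: the suspension of `X` on the level
of objects. -/
noncomputable def cosyzygy (X : F) : F := (hS.ι_mono X).choose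

/-- The projection to the cokernel of the chosen injective preenvelope of `X`. -/
noncomputable def q (X : F) : hS.hull X ⟶ hS.cosyzygy X := (hS.ι_mono X).choose_spec.choose

@[simp]
lemma ι_q (X : F) : hS.ι X ≫ hS.q X = 0 := (hS.ι_mono X).choose_spec.choose_spec.choose

/-- The conflation given by the chosen injective preenvelope of `X`. -/
noncomputable abbrev hullSeq (X : F) : ShortComplex F := ⟨hS.ι X, hS.q X, hS.ι_q X⟩

lemma hullSeq_conflation (X : F) : S.conflation (hS.hullSeq X) :=
  (hS.ι_mono X).choose_spec.choose_spec.choose_spec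

variable {T : ShortComplex F}

/-- A morphism `a` from the first object of a conflation to `X` extends to a morphism of
conflations, to the chosen injective preenvelope of `X`. -/
lemma exists_ext (hT : S.conflation T) {X : F} (a : T.X₁ ⟶ X) :
    ∃ (w : T.X₃ ⟶ hS.cosyzygy X) (u : T.X₂ ⟶ hS.hull X),
      T.f ≫ u = a ≫ hS.ι X ∧ T.g ≫ w = u ≫ hS.q X := by
  obtain ⟨u, hu⟩ := hS.hull_injective X T hT (a ≫ hS.ι X)
  obtain ⟨w, hw⟩ := exists_desc hT (u ≫ hS.q X) (by rw [reassoc_of% hu]; simp)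
  exact ⟨w, u, hu, hw⟩

/-- The third component of such an extension of `a`. -/
noncomputable def ext (hT : S.conflation T) {X : F} (a : T.X₁ ⟶ X) : T.X₃ ⟶ hS.cosyzygy X :=
  (hS.exists_ext hT a).choose

lemma ext_spec (hT : S.conflation T) {X : F} (a : T.X₁ ⟶ X) : ∃ u : T.X₂ ⟶ hS.hull X,
    T.f ≫ u = a ≫ hS.ι X ∧ T.g ≫ hS.ext hT a = u ≫ hS.q X :=
  (hS.exists_ext hT a).choose_spec

/-- The stable class of the third component depends only on the stable class of `a`. -/
lemma ext_unique (hT : S.conflation T) {X : F} {a a' : T.X₁ ⟶ X} {w w' : T.X₃ ⟶ hS.cosyzygy X}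
    {u u' : T.X₂ ⟶ hS.hull X} (h : T.f ≫ u = a ≫ hS.ι X) (h' : T.f ≫ u' = a' ≫ hS.ι X)
    (hw : T.g ≫ w = u ≫ hS.q X) (hw' : T.g ≫ w' = u' ≫ hS.q X)
    (ha : S.toStable.map a = S.toStable.map a') : S.toStable.map w = S.toStable.map w' := by
  rw [map_eq_iff] at ha ⊢
  obtain ⟨P, hP, b, c, hbc⟩ := ha
  obtain ⟨b', hb'⟩ := (hS.projective_iff_injective P).1 hP T hT b
  have := epi_g hT
  obtain ⟨t, ht⟩ := exists_desc hT (u - u' - b' ≫ c ≫ hS.ι X) (by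
    rw [Preadditive.comp_sub, Preadditive.comp_sub, h, h', reassoc_of% hb', ← Preadditive.sub_comp,
      hbc, Category.assoc, sub_self])
  refine ⟨_, hS.hull_projective X, t, hS.q X, ?_⟩
  rw [← cancel_epi T.g, reassoc_of% ht]
  simp [Preadditive.comp_sub, Preadditive.sub_comp, hw, hw']

lemma map_ext_eq (hT : S.conflation T) {X : F} {a : T.X₁ ⟶ X} {w : T.X₃ ⟶ hS.cosyzygy X}
    {u : T.X₂ ⟶ hS.hull X} (h : T.f ≫ u = a ≫ hS.ι X) (hw : T.g ≫ w = u ≫ hS.q X) :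
    S.toStable.map (hS.ext hT a) = S.toStable.map w := by
  obtain ⟨u', h', hw'⟩ := hS.ext_spec hT a
  exact hS.ext_unique hT h' h hw' hw rfl

/-- The suspension functor of the stable category, before passing to the quotient. -/
noncomputable def preSusp : F ⥤ S.Stable where
  obj X := S.toStable.obj (hS.cosyzygy X)
  map {X Y} a := S.toStable.map (hS.ext (hS.hullSeq_conflation X) a)
  map_id X := by
    rw [← S.toStable.map_id]
    exact hS.map_ext_eq (hS.hullSeq_conflation X) (u := 𝟙 _)
      ((Category.comp_id _).trans (Category.id_comp _).symm)
      ((Category.comp_id _).trans (Category.id_comp _).symm)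
  map_comp {X Y Z} a b := by
    rw [← S.toStable.map_comp]
    obtain ⟨u, h, hw⟩ := hS.ext_spec (hS.hullSeq_conflation X) a
    obtain ⟨u', h', hw'⟩ := hS.ext_spec (hS.hullSeq_conflation Y) b
    dsimp only at h hw h' hw'
    exact hS.map_ext_eq (hS.hullSeq_conflation X) (u := u ≫ u')
      (by dsimp only; rw [reassoc_of% h, h', Category.assoc])
      (by dsimp only; rw [reassoc_of% hw, hw', Category.assoc])

/-- The suspension functor of the stable category. On objects it is the cokernel of the chosen
injective preenvelope, on morphisms it is induced by a choice of extension to the injective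
preenvelopes. -/
noncomputable def susp : S.Stable ⥤ S.Stable :=
  CategoryTheory.Quotient.lift _ hS.preSusp (fun X Y a b hab => by
      obtain ⟨u, h, hw⟩ := hS.ext_spec (hS.hullSeq_conflation X) a
      obtain ⟨u', h', hw'⟩ := hS.ext_spec (hS.hullSeq_conflation X) b
      exact hS.ext_unique (hS.hullSeq_conflation X) h h' hw hw'
        (CategoryTheory.Quotient.sound _ hab))

lemma susp_map {X Y : F} (a : X ⟶ Y) : hS.susp.map (S.toStable.map a) =
    S.toStable.map (hS.ext (hS.hullSeq_conflation X) a) := rfl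

/-- The image triangle `M' ⟶ M ⟶ M'' ⟶ Σ M'` in the stable category of a conflation
`M' ⟶ M ⟶ M''`. The last map is induced by an extension of the injective preenvelope of `M'`
to `M`. -/
noncomputable def imageTriangle (T : ShortComplex F) (hT : S.conflation T) : Tri hS.susp where
  X := S.toStable.obj T.X₁
  Y := S.toStable.obj T.X₂
  Z := S.toStable.obj T.X₃
  f := S.toStable.map T.f
  g := S.toStable.map T.g
  h := S.toStable.map (hS.ext hT (𝟙 T.X₁))

/-- The triangulation of the stable category of a Frobenius exact category: the distinguished
triangles are those isomorphic to the image triangles of the conflations. -/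
noncomputable def stableData : TriangleData S.Stable where
  susp := hS.susp
  dist T := ∃ (T₀ : ShortComplex F) (h₀ : S.conflation T₀), Nonempty (hS.imageTriangle T₀ h₀ ≅ T)

lemma susp_map_eq {X Y : F} {a : X ⟶ Y} {w : hS.cosyzygy X ⟶ hS.cosyzygy Y}
    {u : hS.hull X ⟶ hS.hull Y} (h : hS.ι X ≫ u = a ≫ hS.ι Y) (hw : hS.q X ≫ w = u ≫ hS.q Y) :
    hS.susp.map (S.toStable.map a) = S.toStable.map w :=
  hS.map_ext_eq (hS.hullSeq_conflation X) h hw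

lemma exists_susp {X Y : F} (a : X ⟶ Y) :
    ∃ (w : hS.cosyzygy X ⟶ hS.cosyzygy Y) (u : hS.hull X ⟶ hS.hull Y),
      hS.ι X ≫ u = a ≫ hS.ι Y ∧ hS.q X ≫ w = u ≫ hS.q Y :=
  hS.exists_ext (hS.hullSeq_conflation X) a

instance susp_additive : hS.susp.Additive where
  map_add := by
    intro X Y f g
    obtain ⟨a, rfl⟩ := S.toStable.map_surjective f
    obtain ⟨b, rfl⟩ := S.toStable.map_surjective g
    obtain ⟨w, u, h, hw⟩ := hS.exists_susp a
    obtain ⟨w', u', h', hw'⟩ := hS.exists_susp b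
    have e := hS.susp_map_eq (a := a + b) (w := w + w') (u := u + u')
      (by rw [Preadditive.comp_add, h, h', Preadditive.add_comp])
      (by rw [Preadditive.comp_add, hw, hw', Preadditive.add_comp])
    rw [← Functor.map_add]
    exact e.trans (S.toStable.map_add.trans (congr_arg₂ (· + ·) (hS.susp_map_eq h hw).symm
      (hS.susp_map_eq h' hw').symm))

section

variable {T : ShortComplex F} (hT : S.conflation T)

lemma connecting_spec (hT : S.conflation T) :
    ∃ (w : T.X₃ ⟶ hS.cosyzygy T.X₁) (u : T.X₂ ⟶ hS.hull T.X₁),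
      T.f ≫ u = hS.ι T.X₁ ∧ T.g ≫ w = u ≫ hS.q T.X₁ ∧
      (hS.imageTriangle T hT).h = S.toStable.map w := by
  obtain ⟨w, u, h, hw⟩ := hS.exists_ext hT (𝟙 T.X₁)
  exact ⟨w, u, by rw [h, Category.id_comp], hw, hS.map_ext_eq hT h hw⟩

lemma image_comp₁₂ (hT : S.conflation T) :
    (hS.imageTriangle T hT).f ≫ (hS.imageTriangle T hT).g = 0 := by
  change S.toStable.map T.f ≫ S.toStable.map T.g =
    (0 : S.toStable.obj T.X₁ ⟶ S.toStable.obj T.X₃)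
  rw [← Functor.map_comp, T.zero, Functor.map_zero]

lemma image_comp₂₃ (hT : S.conflation T) :
    (hS.imageTriangle T hT).g ≫ (hS.imageTriangle T hT).h = 0 := by
  obtain ⟨w, u, h, hw, e⟩ := hS.connecting_spec hT
  rw [e]
  change S.toStable.map T.g ≫ S.toStable.map w = 0
  rw [← Functor.map_comp, map_eq_zero_iff]
  exact ⟨_, hS.hull_projective _, _, _, hw⟩

lemma image_comp₃₁ (hT : S.conflation T) :
    (hS.imageTriangle T hT).h ≫ hS.susp.map (hS.imageTriangle T hT).f = 0 := by
  obtain ⟨w, u, h, hw, e⟩ := hS.connecting_spec hT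
  obtain ⟨w', u', h', hw'⟩ := hS.exists_susp T.f
  rw [e]
  refine (congr_arg (S.toStable.map w ≫ ·) (hS.susp_map_eq h' hw')).trans ?_
  change S.toStable.map w ≫ S.toStable.map w' =
    (0 : S.toStable.obj T.X₃ ⟶ S.toStable.obj (hS.cosyzygy T.X₂))
  rw [← Functor.map_comp, map_eq_zero_iff]
  obtain ⟨r, hr⟩ := exists_desc hT (hS.ι T.X₂ - u ≫ u') (by
    rw [Preadditive.comp_sub, reassoc_of% h, h', sub_self])
  have := epi_g hT
  refine ⟨_, hS.hull_projective _, -r, hS.q _, ?_⟩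
  rw [← cancel_epi T.g, reassoc_of% hw, hw', Preadditive.neg_comp, Preadditive.comp_neg,
    reassoc_of% hr]
  simp [Preadditive.sub_comp]

lemma image_fill {T' : ShortComplex F} (hT : S.conflation T) (hT' : S.conflation T')
    (a : (hS.imageTriangle T hT).X ⟶ (hS.imageTriangle T' hT').X)
    (b : (hS.imageTriangle T hT).Y ⟶ (hS.imageTriangle T' hT').Y)
    (comm : (hS.imageTriangle T hT).f ≫ b = a ≫ (hS.imageTriangle T' hT').f) :
    ∃ c : (hS.imageTriangle T hT).Z ⟶ (hS.imageTriangle T' hT').Z,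
      (hS.imageTriangle T hT).g ≫ c = b ≫ (hS.imageTriangle T' hT').g ∧
      (hS.imageTriangle T hT).h ≫ hS.susp.map a = c ≫ (hS.imageTriangle T' hT').h := by
  obtain ⟨w, u, h, hw, e⟩ := hS.connecting_spec hT
  obtain ⟨w', u', h', hw', e'⟩ := hS.connecting_spec hT'
  rw [e, e']
  dsimp only [imageTriangle] at a b comm ⊢
  obtain ⟨a, rfl⟩ := S.toStable.map_surjective a
  obtain ⟨b, rfl⟩ := S.toStable.map_surjective b
  rw [← Functor.map_comp, ← Functor.map_comp, map_eq_iff] at comm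
  obtain ⟨P, hP, s, t, hst⟩ := comm
  obtain ⟨s', hs'⟩ := (hS.projective_iff_injective P).1 hP T hT s
  have hb : T.f ≫ (b - s' ≫ t) = a ≫ T'.f := by
    rw [Preadditive.comp_sub, reassoc_of% hs', ← hst]
    abel
  have hb' : S.toStable.map (b - s' ≫ t) = S.toStable.map b := by
    rw [map_eq_iff]
    exact ⟨P, hP, -s', t, by simp⟩
  rw [← hb']
  generalize b - s' ≫ t = b at hb
  obtain ⟨c, hc⟩ := exists_desc hT (b ≫ T'.g) (by
    rw [reassoc_of% hb, T'.zero, comp_zero])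
  obtain ⟨w₁, u₁, h₁, hw₁⟩ := hS.exists_susp a
  refine ⟨S.toStable.map c, by rw [← Functor.map_comp, ← Functor.map_comp, hc], ?_⟩
  refine (congr_arg (S.toStable.map w ≫ ·) (hS.susp_map_eq h₁ hw₁)).trans ?_
  change S.toStable.map w ≫ S.toStable.map w₁ = S.toStable.map c ≫ S.toStable.map w'
  rw [← Functor.map_comp, ← Functor.map_comp, map_eq_iff]
  obtain ⟨r, hr⟩ := exists_desc hT (u ≫ u₁ - b ≫ u') (by
    rw [Preadditive.comp_sub, reassoc_of% h, reassoc_of% hb, h', h₁, sub_self])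
  have := epi_g hT
  refine ⟨_, hS.hull_projective _, r, hS.q _, ?_⟩
  rw [← cancel_epi T.g, reassoc_of% hr, Preadditive.comp_sub, reassoc_of% hw, reassoc_of% hc,
    hw', hw₁, Preadditive.sub_comp, Category.assoc, Category.assoc]

lemma image_desc₂ (hT : S.conflation T) {W : S.Stable} (u : (hS.imageTriangle T hT).Y ⟶ W)
    (hu : (hS.imageTriangle T hT).f ≫ u = 0) :
    ∃ v : (hS.imageTriangle T hT).Z ⟶ W, u = (hS.imageTriangle T hT).g ≫ v := by
  obtain ⟨W⟩ := W
  dsimp only [imageTriangle] at u hu ⊢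
  obtain ⟨u, rfl⟩ := S.toStable.map_surjective u
  change S.toStable.map T.f ≫ S.toStable.map u =
    (0 : S.toStable.obj T.X₁ ⟶ S.toStable.obj W) at hu
  rw [← Functor.map_comp, map_eq_zero_iff] at hu
  obtain ⟨P, hP, s, t, hst⟩ := hu
  obtain ⟨s', hs'⟩ := (hS.projective_iff_injective P).1 hP T hT s
  obtain ⟨v, hv⟩ := exists_desc hT (u - s' ≫ t) (by
    rw [Preadditive.comp_sub, reassoc_of% hs', hst, sub_self])
  refine ⟨S.toStable.map v, ?_⟩
  rw [← Functor.map_comp, map_eq_iff, hv]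
  exact ⟨P, hP, s', t, by simp⟩

lemma image_desc₃ (hT : S.conflation T) {W : S.Stable} (u : (hS.imageTriangle T hT).Z ⟶ W)
    (hu : (hS.imageTriangle T hT).g ≫ u = 0) :
    ∃ v : hS.susp.obj (hS.imageTriangle T hT).X ⟶ W, u = (hS.imageTriangle T hT).h ≫ v := by
  obtain ⟨W⟩ := W
  obtain ⟨w, j, h, hw, e⟩ := hS.connecting_spec hT
  rw [e]
  dsimp only [imageTriangle] at u hu ⊢
  obtain ⟨u, rfl⟩ := S.toStable.map_surjective u
  change S.toStable.map T.g ≫ S.toStable.map u =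
    (0 : S.toStable.obj T.X₂ ⟶ S.toStable.obj W) at hu
  rw [← Functor.map_comp, map_eq_zero_iff] at hu
  obtain ⟨P, hP, s, t, hst⟩ := hu
  obtain ⟨k, hk⟩ := (hS.projective_iff_injective P).1 hP _ (hS.hullSeq_conflation T.X₁) (T.f ≫ s)
  obtain ⟨r, hr⟩ := exists_desc hT (s - j ≫ k) (by
    rw [Preadditive.comp_sub, reassoc_of% h, hk, sub_self])
  dsimp only at k hk
  obtain ⟨v, hv⟩ := exists_desc (hS.hullSeq_conflation T.X₁) (k ≫ t) (by
    dsimp only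
    rw [reassoc_of% hk, ← hst, ← Category.assoc, T.zero, zero_comp])
  dsimp only at v hv
  refine ⟨S.toStable.map v, ?_⟩
  change S.toStable.map u = S.toStable.map w ≫ S.toStable.map v
  rw [← Functor.map_comp, map_eq_iff]
  have := epi_g hT
  refine ⟨P, hP, r, t, ?_⟩
  rw [← cancel_epi T.g, reassoc_of% hr, Preadditive.comp_sub, hst, reassoc_of% hw, hv,
    Preadditive.sub_comp, Category.assoc]

lemma image_lift₃ (hT : S.conflation T) {W : S.Stable} (u : W ⟶ (hS.imageTriangle T hT).Z)
    (hu : u ≫ (hS.imageTriangle T hT).h = 0) :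
    ∃ v : W ⟶ (hS.imageTriangle T hT).Y, u = v ≫ (hS.imageTriangle T hT).g := by
  obtain ⟨W⟩ := W
  obtain ⟨w, j, h, hw, e⟩ := hS.connecting_spec hT
  rw [e] at hu
  dsimp only [imageTriangle] at u hu ⊢
  obtain ⟨u, rfl⟩ := S.toStable.map_surjective u
  change S.toStable.map u ≫ S.toStable.map w = 0 at hu
  rw [← Functor.map_comp, map_eq_zero_iff] at hu
  obtain ⟨P, hP, s, t, hst⟩ := hu
  obtain ⟨t', ht'⟩ := hP _ (hS.hullSeq_conflation T.X₁) t
  dsimp only at t' ht'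
  obtain ⟨W', b, p, sq, K, i, hi, hK⟩ := S.pullback T.g u ⟨_, T.f, T.zero, hT⟩
  have := epi_g hK
  dsimp only at this
  let i' : T.X₁ ⟶ W' := sq.lift T.f 0 (by simp [T.zero])
  have hi'b : i' ≫ b = T.f := sq.lift_fst _ _ _
  have hi'p : i' ≫ p = 0 := sq.lift_snd _ _ _
  obtain ⟨c, hc⟩ := exists_lift hT (i ≫ b) (by
    rw [Category.assoc, sq.w, reassoc_of% hi, zero_comp])
  have hc' : c ≫ i' = i := by
    apply sq.hom_ext
    · rw [Category.assoc, hi'b, hc]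
    · rw [Category.assoc, hi'p, hi, comp_zero]
  obtain ⟨d, hd⟩ := exists_lift (hS.hullSeq_conflation T.X₁) (b ≫ j - p ≫ s ≫ t') (by
    dsimp only
    rw [Preadditive.sub_comp]
    simp only [Category.assoc]
    rw [ht', ← hst, ← hw, reassoc_of% sq.w, sub_self])
  dsimp only at d hd
  have hd' : i' ≫ d ≫ hS.ι T.X₁ = hS.ι T.X₁ := by
    rw [hd, Preadditive.comp_sub, reassoc_of% hi'b, h, reassoc_of% hi'p, zero_comp, sub_zero]
  have hmono : Mono (hS.ι T.X₁) := ⟨fun _ _ hh =>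
    Fork.IsLimit.hom_ext (S.kernel _ (hS.hullSeq_conflation T.X₁)).some hh⟩
  have hd'' : i' ≫ d = 𝟙 _ := by
    rw [← cancel_mono (hS.ι T.X₁), Category.assoc, hd', Category.id_comp]
  have hid : i ≫ d = c := by rw [← hc', Category.assoc, hd'', Category.comp_id]
  obtain ⟨v, hv⟩ := exists_desc hK (b - d ≫ T.f) (by
    dsimp only
    rw [Preadditive.comp_sub, reassoc_of% hid, hc, sub_self])
  dsimp only at v hv
  refine ⟨S.toStable.map v, ?_⟩
  rw [← Functor.map_comp]
  congr 1
  rw [← cancel_epi p, reassoc_of% hv, Preadditive.sub_comp, Category.assoc, T.zero, comp_zero,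
    sub_zero, sq.w]

end

instance : hS.stableData.IsHomExact where
  additive := hS.susp_additive
  comp₁₂ := by
    rintro T ⟨T₀, h₀, ⟨e⟩⟩
    exact Tri.comp₁₂_of_iso e (hS.image_comp₁₂ h₀)
  comp₂₃ := by
    rintro T ⟨T₀, h₀, ⟨e⟩⟩
    exact Tri.comp₂₃_of_iso e (hS.image_comp₂₃ h₀)
  comp₃₁ := by
    rintro T ⟨T₀, h₀, ⟨e⟩⟩
    exact Tri.comp₃₁_of_iso e (hS.image_comp₃₁ h₀)
  fill := by
    rintro T T' ⟨T₀, h₀, ⟨e⟩⟩ ⟨T₀', h₀', ⟨e'⟩⟩ a b comm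
    exact Tri.fill_of_iso e e' (hS.image_fill h₀ h₀') a b comm
  desc₂ := by
    rintro T ⟨T₀, h₀, ⟨e⟩⟩ W u hu
    exact Tri.desc₂_of_iso e (hS.image_desc₂ h₀) u hu
  desc₃ := by
    rintro T ⟨T₀, h₀, ⟨e⟩⟩ W u hu
    exact Tri.desc₃_of_iso e (hS.image_desc₃ h₀) u hu
  lift₃ := by
    rintro T ⟨T₀, h₀, ⟨e⟩⟩ W u hu
    exact Tri.lift₃_of_iso e (hS.image_lift₃ h₀) u hu

end IsFrobenius

end ExactStructure

end Exact

/-! ## Proper classes and Frobenius classes of triangles -/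

section ProperClass

variable {K : Type u} [Category.{v} K] [Preadditive K]

/-- The square `f ≫ b = a ≫ g` is homotopy cartesian (equivalently: `b` and `g` form a homotopy
pushout of `f` and `a`; `f` and `a` form a homotopy pullback of `b` and `g`): there is a
distinguished triangle `W ⟶ Y ⊕ X ⟶ Z ⟶ Σ W` with maps `(f, -a)` and `(b, g)`. -/
def IsHomotopyCartesian (D : TriangleData K) {W X Y Z : K} (f : W ⟶ Y) (a : W ⟶ X) (b : Y ⟶ Z)
    (g : X ⟶ Z) : Prop :=
  ∃ (s : BinaryBicone Y X) (_ : Nonempty s.IsBilimit) (δ : Z ⟶ D.susp.obj W),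
    D.dist ⟨f ≫ s.inl - a ≫ s.inr, s.fst ≫ b + s.snd ≫ g, δ⟩

section

variable {S : K ⥤ K} (E : Tri S → Prop)

/-- `f` is the first map of a triangle in the class `E`. -/
def IsEMono {X Y : K} (f : X ⟶ Y) : Prop := ∃ (Z : K) (g : Y ⟶ Z) (h : Z ⟶ S.obj X), E ⟨f, g, h⟩

/-- `g` is the second map of a triangle in the class `E`. -/
def IsEEpi {Y Z : K} (g : Y ⟶ Z) : Prop := ∃ (X : K) (f : X ⟶ Y) (h : Z ⟶ S.obj X), E ⟨f, g, h⟩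

/-- `P` is `E`-projective: for each triangle of `E`, the sequence
`0 ⟶ K(P, X) ⟶ K(P, Y) ⟶ K(P, Z) ⟶ 0` is exact. -/
def IsEProjective : ObjectProperty K := fun P => ∀ T : Tri S, E T →
  Function.Injective (fun u : P ⟶ T.X => u ≫ T.f) ∧
  Function.Exact (fun u : P ⟶ T.X => u ≫ T.f) (fun u : P ⟶ T.Y => u ≫ T.g) ∧
  Function.Surjective (fun u : P ⟶ T.Y => u ≫ T.g)

/-- `J` is `E`-injective: for each triangle of `E`, the sequence
`0 ⟶ K(Z, J) ⟶ K(Y, J) ⟶ K(X, J) ⟶ 0` is exact. -/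
def IsEInjective : ObjectProperty K := fun J => ∀ T : Tri S, E T →
  Function.Injective (fun u : T.Z ⟶ J => T.g ≫ u) ∧
  Function.Exact (fun u : T.Z ⟶ J => T.g ≫ u) (fun u : T.Y ⟶ J => T.f ≫ u) ∧
  Function.Surjective (fun u : T.Y ⟶ J => T.f ≫ u)

instance [HasZeroObject K] [HasBinaryBiproducts K] : IsSumClosed (IsEProjective E) where
  zero := by
    obtain ⟨Z, hZ⟩ := HasZeroObject.zero (C := K)
    refine ⟨Z, hZ, fun T _ => ⟨fun u v _ => hZ.eq_of_src _ _, fun u => ?_, fun u => ?_⟩⟩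
    · exact ⟨fun _ => ⟨0, hZ.eq_of_src _ _⟩, fun _ => hZ.eq_of_src _ _⟩
    · exact ⟨0, hZ.eq_of_src _ _⟩
  sum := by
    intro P Q hP hQ T hT
    obtain ⟨p₁, p₂, p₃⟩ := hP T hT
    obtain ⟨q₁, q₂, q₃⟩ := hQ T hT
    refine ⟨fun u v h => ?_, fun u => ⟨fun h => ?_, ?_⟩, fun u => ?_⟩
    · dsimp only at h
      ext
      · exact p₁ (by simp [h])
      · exact q₁ (by simp [h])
    · dsimp only at h
      obtain ⟨a, ha⟩ := (p₂ (biprod.inl ≫ u)).1 (by simp [h])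
      obtain ⟨b, hb⟩ := (q₂ (biprod.inr ≫ u)).1 (by simp [h])
      exact ⟨biprod.desc a b, by ext <;> simpa⟩
    · rintro ⟨v, rfl⟩
      have h₁ := (p₂ (biprod.inl ≫ v ≫ T.f)).2 ⟨biprod.inl ≫ v, by simp⟩
      have h₂ := (q₂ (biprod.inr ≫ v ≫ T.f)).2 ⟨biprod.inr ≫ v, by simp⟩
      dsimp only at h₁ h₂ ⊢
      ext
      · simpa using h₁
      · simpa using h₂
    · obtain ⟨a, ha⟩ := p₃ (biprod.inl ≫ u)
      obtain ⟨b, hb⟩ := q₃ (biprod.inr ≫ u)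
      exact ⟨biprod.desc a b, by ext <;> simpa⟩

end

/-- Proper classes of triangles: classes of distinguished triangles closed under isomorphisms,
suspension and desuspension, direct sums and retracts (among distinguished triangles), which contain the trivial triangles, whose
monomorphisms are closed under homotopy pushouts, whose epimorphisms are closed under homotopy
pullbacks, and which are saturated. -/
structure IsProperClass (D : TriangleData K) (E : Tri D.susp → Prop) : Prop where
  dist : ∀ T, E T → D.dist T
  of_iso : ∀ T T', (T ≅ T') → E T → E T'
  suspend_iff : ∀ T, E T.suspend ↔ E T
  sum : ∀ T T₁ T₂, T.IsDirectSum T₁ T₂ → E T₁ → E T₂ → E T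
  retract : ∀ T T', Retract T' T → D.dist T' → E T → E T'
  trivial₁ : ∀ X Z : K, IsZero Z → E ⟨𝟙 X, (0 : X ⟶ Z), 0⟩
  trivial₂ : ∀ Y Z : K, IsZero Z → E ⟨(0 : Z ⟶ Y), 𝟙 Y, 0⟩
  pushout : ∀ {W X Y Z : K} (f : W ⟶ Y) (a : W ⟶ X) (b : Y ⟶ Z) (g : X ⟶ Z),
    IsHomotopyCartesian D f a b g → IsEMono E f → IsEMono E g
  pullback : ∀ {W X Y Z : K} (f : W ⟶ Y) (a : W ⟶ X) (b : Y ⟶ Z) (g : X ⟶ Z),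
    IsHomotopyCartesian D f a b g → IsEEpi E g → IsEEpi E f
  saturated : ∀ {W X Y Z : K} (f : W ⟶ Y) (a : W ⟶ X) (b : Y ⟶ Z) (g : X ⟶ Z),
    IsHomotopyCartesian D f a b g → IsEEpi E b → IsEEpi E f → IsEEpi E g

/-- Frobenius classes of triangles: proper classes with enough projectives and enough injectives,
and such that these coincide. -/
structure IsFrobeniusClass (D : TriangleData K) (E : Tri D.susp → Prop) : Prop
    extends IsProperClass D E where
  enough_projectives : ∀ X : K, ∃ (P : K) (p : P ⟶ X), IsEProjective E P ∧ IsEEpi E p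
  enough_injectives : ∀ X : K, ∃ (J : K) (j : X ⟶ J), IsEInjective E J ∧ IsEMono E j
  projective_iff_injective : ∀ X : K, IsEProjective E X ↔ IsEInjective E X

end ProperClass

/-! ## The relative stable category -/

section Relative

variable {K : Type u} [Category.{v} K] [Preadditive K]

/-- The relative stable category `K / E`: the additive quotient of `K` by the `E`-projective
objects (which for a Frobenius class are the `E`-projective-injective objects). -/
abbrev Relative {S : K ⥤ K} (E : Tri S → Prop) := AddQuotient (IsEProjective E)

/-- The quotient functor to the relative stable category. -/
abbrev toRelative {S : K ⥤ K} (E : Tri S → Prop) : K ⥤ Relative E :=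
  toAddQuotient (IsEProjective E)

namespace IsFrobeniusClass

variable {D : TriangleData K} {E : Tri D.susp → Prop} (hE : IsFrobeniusClass D E)

/-- The target of the chosen `E`-injective preenvelope of `X`. -/
noncomputable def hull (X : K) : K := (hE.enough_injectives X).choose

/-- The chosen `E`-injective preenvelope of `X`. -/
noncomputable def ι (X : K) : X ⟶ hE.hull X := (hE.enough_injectives X).choose_spec.choose

lemma hull_injective (X : K) : IsEInjective E (hE.hull X) :=
  (hE.enough_injectives X).choose_spec.choose_spec.1

lemma hull_projective (X : K) : IsEProjective E (hE.hull X) :=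
  (hE.projective_iff_injective _).2 (hE.hull_injective X)

lemma ι_mono (X : K) : IsEMono E (hE.ι X) :=
  (hE.enough_injectives X).choose_spec.choose_spec.2

/-- The cofibre of the chosen `E`-injective preenvelope of `X`: the relative suspension of `X` on
the level of objects. -/
noncomputable def cosyzygy (X : K) : K := (hE.ι_mono X).choose

/-- The second map of the chosen triangle `X ⟶ hull X ⟶ cosyzygy X ⟶ Σ X` of `E`. -/
noncomputable def q (X : K) : hE.hull X ⟶ hE.cosyzygy X := (hE.ι_mono X).choose_spec.choose

/-- The third map of the chosen triangle `X ⟶ hull X ⟶ cosyzygy X ⟶ Σ X` of `E`. -/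
noncomputable def δ (X : K) : hE.cosyzygy X ⟶ D.susp.obj X :=
  (hE.ι_mono X).choose_spec.choose_spec.choose

/-- The chosen triangle `X ⟶ hull X ⟶ cosyzygy X ⟶ Σ X` of `E`. -/
noncomputable abbrev hullTri (X : K) : Tri D.susp := ⟨hE.ι X, hE.q X, hE.δ X⟩

lemma hullTri_mem (X : K) : E (hE.hullTri X) :=
  (hE.ι_mono X).choose_spec.choose_spec.choose_spec

lemma hullTri_dist (X : K) : D.dist (hE.hullTri X) := hE.dist _ (hE.hullTri_mem X)

lemma exists_extend {X J : K} (hJ : IsEInjective E J) (a : X ⟶ J) :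
    ∃ b : hE.hull X ⟶ J, hE.ι X ≫ b = a :=
  (hJ _ (hE.hullTri_mem X)).2.2 a

variable [D.IsHomExact]

/-- A morphism `a : X ⟶ Y` extends to a morphism between the chosen triangles. -/
lemma exists_ext {X Y : K} (a : X ⟶ Y) :
    ∃ (w : hE.cosyzygy X ⟶ hE.cosyzygy Y) (u : hE.hull X ⟶ hE.hull Y),
      hE.ι X ≫ u = a ≫ hE.ι Y ∧ hE.q X ≫ w = u ≫ hE.q Y ∧ hE.δ X ≫ D.susp.map a = w ≫ hE.δ Y := by
  obtain ⟨u, hu⟩ := hE.exists_extend (hE.hull_injective Y) (a ≫ hE.ι Y)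
  obtain ⟨w, hw, hw'⟩ := TriangleData.IsHomExact.fill _ _ (hE.hullTri_dist X) (hE.hullTri_dist Y)
    a u hu
  exact ⟨w, u, hu, hw, hw'⟩

/-- The third component of such an extension of `a`. -/
noncomputable def ext {X Y : K} (a : X ⟶ Y) : hE.cosyzygy X ⟶ hE.cosyzygy Y :=
  (hE.exists_ext a).choose

lemma ext_spec {X Y : K} (a : X ⟶ Y) : ∃ u : hE.hull X ⟶ hE.hull Y,
    hE.ι X ≫ u = a ≫ hE.ι Y ∧ hE.q X ≫ hE.ext a = u ≫ hE.q Y ∧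
      hE.δ X ≫ D.susp.map a = hE.ext a ≫ hE.δ Y :=
  (hE.exists_ext a).choose_spec

variable [HasZeroObject K] [HasBinaryBiproducts K]

/-- The class of the third component in the relative stable category depends only on the class
of `a`. -/
lemma ext_unique {X Y : K} {a a' : X ⟶ Y} {w w' : hE.cosyzygy X ⟶ hE.cosyzygy Y}
    {u u' : hE.hull X ⟶ hE.hull Y}
    (h₁ : hE.ι X ≫ u = a ≫ hE.ι Y) (h₂ : hE.q X ≫ w = u ≫ hE.q Y)
    (h₃ : hE.δ X ≫ D.susp.map a = w ≫ hE.δ Y)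
    (h₁' : hE.ι X ≫ u' = a' ≫ hE.ι Y) (h₂' : hE.q X ≫ w' = u' ≫ hE.q Y)
    (h₃' : hE.δ X ≫ D.susp.map a' = w' ≫ hE.δ Y)
    (ha : (toRelative E).map a = (toRelative E).map a') :
    (toRelative E).map w = (toRelative E).map w' := by
  have := TriangleData.IsHomExact.additive (D := D)
  rw [map_eq_iff] at ha ⊢
  obtain ⟨P, hP, b, c, hbc⟩ := ha
  obtain ⟨b', hb'⟩ := hE.exists_extend ((hE.projective_iff_injective P).1 hP) b
  have hιq : hE.ι Y ≫ hE.q Y = 0 := TriangleData.IsHomExact.comp₁₂ _ (hE.hullTri_dist Y)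
  have hqδ : hE.q Y ≫ hE.δ Y = 0 := TriangleData.IsHomExact.comp₂₃ _ (hE.hullTri_dist Y)
  have hδι : hE.δ X ≫ D.susp.map (hE.ι X) = 0 :=
    TriangleData.IsHomExact.comp₃₁ _ (hE.hullTri_dist X)
  obtain ⟨t, ht⟩ := TriangleData.IsHomExact.desc₂ _ (hE.hullTri_dist X)
      (u - u' - b' ≫ c ≫ hE.ι Y) (by
    dsimp only
    rw [Preadditive.comp_sub, Preadditive.comp_sub, h₁, h₁', reassoc_of% hb',
      ← Preadditive.sub_comp, hbc, Category.assoc, sub_self])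
  dsimp only at t ht
  have hu : u = u' + b' ≫ c ≫ hE.ι Y + hE.q X ≫ t := by
    rw [← ht]
    abel
  obtain ⟨s, hs⟩ := TriangleData.IsHomExact.desc₃ _ (hE.hullTri_dist X)
      (w - w' - t ≫ hE.q Y) (by
    dsimp only
    rw [Preadditive.comp_sub, Preadditive.comp_sub, h₂, h₂', hu]
    simp [Preadditive.add_comp, hιq])
  dsimp only at s hs
  obtain ⟨r, hr⟩ := TriangleData.IsHomExact.lift₃ _ (hE.hullTri_dist Y) (hE.δ X ≫ s) (by
    dsimp only
    rw [← hs, Preadditive.sub_comp, Preadditive.sub_comp, ← h₃, ← h₃', ← Preadditive.comp_sub,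
      ← D.susp.map_sub, hbc, ← hb']
    simp only [Functor.map_comp, Category.assoc, hqδ, comp_zero, sub_zero]
    rw [reassoc_of% hδι, zero_comp])
  dsimp only at r hr
  refine ⟨_, hE.hull_projective Y, t + r, hE.q Y, ?_⟩
  rw [Preadditive.add_comp, ← hr, ← hs]
  abel

/-- The relative suspension functor, before passing to the quotient. -/
noncomputable def preSusp : K ⥤ Relative E where
  obj X := (toRelative E).obj (hE.cosyzygy X)
  map {X Y} a := (toRelative E).map (hE.ext a)
  map_id X := by
    rw [← (toRelative E).map_id]
    obtain ⟨u, h₁, h₂, h₃⟩ := hE.ext_spec (𝟙 X)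
    exact hE.ext_unique h₁ h₂ h₃ (u' := 𝟙 _) (by simp) (by simp) (by simp) rfl
  map_comp {X Y Z} a b := by
    rw [← (toRelative E).map_comp]
    obtain ⟨u, h₁, h₂, h₃⟩ := hE.ext_spec (a ≫ b)
    obtain ⟨u', h₁', h₂', h₃'⟩ := hE.ext_spec a
    obtain ⟨u'', h₁'', h₂'', h₃''⟩ := hE.ext_spec b
    exact hE.ext_unique h₁ h₂ h₃ (u' := u' ≫ u'')
      (by rw [reassoc_of% h₁', h₁'', Category.assoc])
      (by rw [reassoc_of% h₂', h₂'', Category.assoc])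
      (by rw [D.susp.map_comp, reassoc_of% h₃', h₃'', Category.assoc]) rfl

/-- The suspension functor of the relative stable category. On objects it is the cofibre of the
chosen `E`-injective preenvelope, on morphisms it is induced by a choice of extension to the chosen
triangles. -/
noncomputable def susp : Relative E ⥤ Relative E :=
  CategoryTheory.Quotient.lift _ hE.preSusp (fun X Y a b hab => by
    obtain ⟨u, h₁, h₂, h₃⟩ := hE.ext_spec a
    obtain ⟨u', h₁', h₂', h₃'⟩ := hE.ext_spec b
    exact hE.ext_unique h₁ h₂ h₃ h₁' h₂' h₃' (CategoryTheory.Quotient.sound _ hab))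

/-- The basic distinguished triangle of the relative stable category given by `f : X ⟶ Y`,
`g : Y ⟶ Z` and `h : Z ⟶ cosyzygy X`. -/
noncomputable def basicTriangle {X Y Z : K} (f : X ⟶ Y) (g : Y ⟶ Z) (h : Z ⟶ hE.cosyzygy X) :
    Tri hE.susp where
  X := (toRelative E).obj X
  Y := (toRelative E).obj Y
  Z := (toRelative E).obj Z
  f := (toRelative E).map f
  g := (toRelative E).map g
  h := (toRelative E).map h

/-- The triangulation of the relative stable category. For a morphism `f : X ⟶ Y` of `K`, form the
homotopy pushout `Z` of `f` along the chosen `E`-injective preenvelope of `X`, with maps `g : Y ⟶ Z`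
and `k : hull X ⟶ Z`, and complete it to a morphism of distinguished triangles of `K`

  `X --> hull X --> cosyzygy X --> Σ X`
  `Y -->   Z    --> cosyzygy X --> Σ Y`

with components `f`, `k`, the identity and `Σ f`. If `h : Z ⟶ cosyzygy X` is the second map in the
lower row, then the image of `(f, g, h)` is a basic distinguished triangle, and the distinguished
triangles are those isomorphic to a basic one. -/
noncomputable def relativeData : TriangleData (Relative E) where
  susp := hE.susp
  dist T := ∃ (X Y Z : K) (f : X ⟶ Y) (g : Y ⟶ Z) (k : hE.hull X ⟶ Z) (h : Z ⟶ hE.cosyzygy X),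
    IsHomotopyCartesian D f (hE.ι X) g k ∧ k ≫ h = hE.q X ∧
    D.dist ⟨g, h, hE.δ X ≫ D.susp.map f⟩ ∧ Nonempty (hE.basicTriangle f g h ≅ T)

end IsFrobeniusClass

end Relative

/-! ## The induced exact structure, and algebraic triangulated categories -/

section Algebraic

/-- The admissible sequences of a Frobenius exact category whose image triangle in the stable
category belongs to the class `E`. -/
def inducedConflation {F : Type u} [Category.{v} F] [Preadditive F] [HasZeroObject F]
    [HasBinaryBiproducts F] {S : ExactStructure F} (hS : S.IsFrobenius)
    (E : Tri hS.stableData.susp → Prop) : ShortComplex F → Prop :=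
  fun T => ∃ hT : S.conflation T, E (hS.imageTriangle T hT)

/-- A category with a suspension and distinguished triangles is algebraic when it is equivalent, as
such, to the stable category of a Frobenius exact category. -/
def IsAlgebraicTriangulation {C : Type u} [Category.{v} C] (D : TriangleData C) : Prop :=
  ∃ (F : Type u') (_ : Category.{v'} F) (_ : Preadditive F) (_ : HasZeroObject F)
    (_ : HasBinaryBiproducts F) (S : ExactStructure F) (hS : S.IsFrobenius),
    Nonempty (TriangleEquiv D hS.stableData)

end Algebraic

end RelStable

open RelStable

/-! The key is a description of $\mathcal S_{\mathcal E}$ that does not mention triangles. The image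
of a conflation lies in `E` if and only if all objects of $\mathcal F$ that are `E`-projective in
$\mathcal K$ lift along its second map (`StableModel.mem_of_lifts`), and if and only if morphisms to
objects that are `E`-injective in $\mathcal K$ extend along its first map
(`StableModel.relativeConflation_iff_extends`).

For the lifting criterion, represent an `E`-epimorphism from an `E`-projective object by a
conflation $A\to Q\to T_3$ and lift $Q\to T_3$ to $T_2$. Then $T$ and the pushout of this conflation
along the induced map $A\to T_1$ have the same connecting map, hence isomorphic image triangles, and
the triangle of the pushout is in `E` because `E`-monomorphisms are closed under homotopy pushouts.
For the extension criterion, map $T$ to a conflation representing an `E`-injective preenvelope of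
$T_1$: the connecting map of $T$ factors through that of the preenvelope, so it becomes zero after
composition with any morphism from an `E`-projective object.

The axioms of an exact structure are then formal: lifting passes to composites and pullbacks,
extension to composites and pushouts. Enough projectives and injectives come from $\mathcal K$,
because every distinguished triangle is isomorphic to the image of a conflation with prescribed
first or last object, at the cost of a projective-injective summand.

The functor $\mathcal F\to\mathcal K/\mathcal E$ is full and essentially surjective, and it kills
exactly the morphisms that factor through an $\mathcal S_{\mathcal E}$-projective object, which
gives the equivalence of categories. Both suspensions are computed by `E`-injective preenvelopes,
and `IsFrobeniusClass.map_c_eq` shows that the choices do not matter in $\mathcal K/\mathcal E$. For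
the triangles, the pushout of a preenvelope conflation $X\to J\to C$ along $f\colon X\to Y$ gives a
conflation $X\to Y\oplus J\to Z$. Since $J$ vanishes in the quotient, this represents the triangle
on $f$ in $\mathcal F/\mathrm{proj}(\mathcal S_{\mathcal E})$. Its last map is minus the map $Z\to
C$ of the basic triangle, so the isomorphism between the suspensions carries a sign.

Both parts of the theorem are instances of one construction for a `StableModel`, a functor $\mathcal
F\to\mathcal K$ which is the stable quotient only up to triangle equivalence. Thus in part (2) the
class `E` never has to be transported. -/

namespace RelStable

/-! ### Uniqueness of distinguished triangles, given two vertices and the map between them. -/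

section

variable {C : Type u} [Category.{v} C]

/-- Three isomorphisms which commute with the maps of two triangles. -/
noncomputable def Tri.isoOfHom {S : C ⥤ C} {T T' : Tri S} (φ : T ⟶ T') [IsIso φ.a] [IsIso φ.b]
    [IsIso φ.c] : T ≅ T' where
  hom := φ
  inv :=
    { a := inv φ.a
      b := inv φ.b
      c := inv φ.c
      comm₁ := by rw [IsIso.eq_inv_comp, ← Category.assoc, IsIso.comp_inv_eq, φ.comm₁]
      comm₂ := by rw [IsIso.eq_inv_comp, ← Category.assoc, IsIso.comp_inv_eq, φ.comm₂]
      comm₃ := by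
        rw [IsIso.eq_inv_comp, ← Category.assoc, Functor.map_inv, IsIso.comp_inv_eq, φ.comm₃] }
  hom_inv_id := Tri.Hom.ext (by simp) (by simp) (by simp)
  inv_hom_id := Tri.Hom.ext (by simp) (by simp) (by simp)

instance {S : C ⥤ C} {T T' : Tri S} (e : T ≅ T') : IsIso e.hom.a :=
  ⟨e.inv.a, Tri.hom_inv_a e, Tri.inv_hom_a e⟩

instance {S : C ⥤ C} {T T' : Tri S} (e : T ≅ T') : IsIso e.hom.b :=
  ⟨e.inv.b, Tri.hom_inv_b e, Tri.inv_hom_b e⟩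

instance {S : C ⥤ C} {T T' : Tri S} (e : T ≅ T') : IsIso e.hom.c :=
  ⟨e.inv.c, Tri.hom_inv_c e, Tri.inv_hom_c e⟩

variable [Preadditive C]

/-- If `φ = 1 + n` with `n² = 0`, the inverse is `1 - n`. This takes the place of the five lemma: an
endomorphism of a distinguished triangle which is the identity at two vertices differs from the
identity at the third by a map of square zero. -/
lemma isIso_of_sub_id_sq_zero {X : C} (φ : X ⟶ X) (h : (φ - 𝟙 X) ≫ (φ - 𝟙 X) = 0) :
    IsIso φ := by
  have h' : φ ≫ φ = φ + φ - 𝟙 X := by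
    simp only [Preadditive.comp_sub, Preadditive.sub_comp, Category.comp_id, Category.id_comp] at h
    rw [sub_sub, sub_eq_zero] at h
    rw [h]
    abel
  exact ⟨𝟙 X + 𝟙 X - φ, by simp [Preadditive.comp_sub, h'], by simp [Preadditive.sub_comp, h']⟩

lemma isIso_of_isIso_comp_both {X Y : C} (f : X ⟶ Y) (g : Y ⟶ X) [IsIso (f ≫ g)]
    [IsIso (g ≫ f)] : IsIso f := by
  have : IsSplitMono f := ⟨⟨⟨g ≫ inv (f ≫ g), by simp [← Category.assoc]⟩⟩⟩
  have : Epi f := epi_of_epi g f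
  exact isIso_of_epi_of_isSplitMono f

/-- Further consequences of the axioms of a triangulated category: distinguished triangles are
closed under isomorphisms, morphisms can be completed at the first vertex, and the contravariant
Hom functors are exact at the first vertex. -/
class TriangleData.IsFillable (D : TriangleData C) : Prop where
  of_iso : ∀ {T T' : Tri D.susp}, (T ≅ T') → D.dist T → D.dist T'
  fill₁ : ∀ T T', D.dist T → D.dist T' → ∀ (b : T.Y ⟶ T'.Y) (c : T.Z ⟶ T'.Z),
    T.g ≫ c = b ≫ T'.g → ∃ a : T.X ⟶ T'.X, T.f ≫ b = a ≫ T'.f ∧ T.h ≫ D.susp.map a = c ≫ T'.h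
  desc₁ : ∀ T, D.dist T → ∀ {W : C} (u : T.X ⟶ W), T.h ≫ D.susp.map u = 0 →
    ∃ v : T.Y ⟶ W, u = T.f ≫ v

namespace TriangleData

variable {D : TriangleData C} [D.IsHomExact] {T T' : Tri D.susp}

/-- The difference `c - 1` factors through `T.h` since `T.g` kills it, while `(c - 1) ≫ T.h = 0`; so
its square vanishes. -/
lemma isIso_c_of_id (hT : D.dist T) (c : T.Z ⟶ T.Z) (h₁ : T.g ≫ c = T.g) (h₂ : c ≫ T.h = T.h) :
    IsIso c := by
  obtain ⟨s, hs⟩ := IsHomExact.desc₃ T hT (c - 𝟙 _) (by rw [Preadditive.comp_sub, h₁]; simp)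
  refine isIso_of_sub_id_sq_zero c ?_
  nth_rw 2 [hs]
  rw [← Category.assoc, Preadditive.sub_comp, h₂]
  simp

/-- A distinguished triangle is determined by its first map. -/
lemma exists_iso_of_f (hT : D.dist T) (hT' : D.dist T') (a : T.X ≅ T'.X) (b : T.Y ≅ T'.Y)
    (comm : T.f ≫ b.hom = a.hom ≫ T'.f) : ∃ e : T ≅ T', e.hom.a = a.hom ∧ e.hom.b = b.hom := by
  obtain ⟨c, h₁, h₂⟩ := IsHomExact.fill T T' hT hT' _ _ comm
  obtain ⟨d, h₃, h₄⟩ := IsHomExact.fill T' T hT' hT a.inv b.inv (by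
    rw [Iso.comp_inv_eq, Category.assoc, comm, a.inv_hom_id_assoc])
  -- The completions `c` and `d` need not be mutually inverse, but each composite belongs to an
  -- endomorphism that is the identity at the other two vertices.
  have := isIso_c_of_id hT (c ≫ d) (by rw [reassoc_of% h₁, h₃, b.hom_inv_id_assoc])
    (by rw [Category.assoc, ← h₄, ← reassoc_of% h₂, ← Functor.map_comp]; simp)
  have := isIso_c_of_id hT' (d ≫ c) (by rw [reassoc_of% h₃, h₁, b.inv_hom_id_assoc])
    (by rw [Category.assoc, ← h₂, ← reassoc_of% h₄, ← Functor.map_comp]; simp)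
  have := isIso_of_isIso_comp_both c d
  let φ : T ⟶ T' := ⟨a.hom, b.hom, c, comm, h₁, h₂⟩
  have : IsIso φ.a := inferInstanceAs (IsIso a.hom)
  have : IsIso φ.b := inferInstanceAs (IsIso b.hom)
  have : IsIso φ.c := inferInstanceAs (IsIso c)
  exact ⟨Tri.isoOfHom φ, rfl, rfl⟩

variable [D.IsFillable]

lemma isIso_a_of_id (hT : D.dist T) (a : T.X ⟶ T.X) (h₁ : a ≫ T.f = T.f)
    (h₂ : T.h ≫ D.susp.map a = T.h) : IsIso a := by
  have := IsHomExact.additive (D := D)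
  obtain ⟨s, hs⟩ := IsFillable.desc₁ T hT (a - 𝟙 _) (by
    rw [Functor.map_sub, Preadditive.comp_sub, h₂]; simp)
  refine isIso_of_sub_id_sq_zero a ?_
  nth_rw 2 [hs]
  rw [← Category.assoc, Preadditive.sub_comp, h₁]
  simp

/-- A distinguished triangle is determined by its second map. -/
lemma exists_iso_of_g (hT : D.dist T) (hT' : D.dist T') (b : T.Y ≅ T'.Y) (c : T.Z ≅ T'.Z)
    (comm : T.g ≫ c.hom = b.hom ≫ T'.g) : ∃ e : T ≅ T', e.hom.b = b.hom ∧ e.hom.c = c.hom := by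
  obtain ⟨a, h₁, h₂⟩ := IsFillable.fill₁ T T' hT hT' _ _ comm
  obtain ⟨d, h₃, h₄⟩ := IsFillable.fill₁ T' T hT' hT b.inv c.inv (by
    rw [Iso.comp_inv_eq, Category.assoc, comm, b.inv_hom_id_assoc])
  have := isIso_a_of_id hT (a ≫ d) (by
      rw [Category.assoc, ← h₃, ← reassoc_of% h₁]; simp)
    (by rw [Functor.map_comp, reassoc_of% h₂, h₄, c.hom_inv_id_assoc])
  have := isIso_a_of_id hT' (d ≫ a) (by
      rw [Category.assoc, ← h₁, ← reassoc_of% h₃]; simp)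
    (by rw [Functor.map_comp, reassoc_of% h₄, h₂, c.inv_hom_id_assoc])
  have := isIso_of_isIso_comp_both a d
  let φ : T ⟶ T' := ⟨a, b.hom, c.hom, h₁, comm, h₂⟩
  have : IsIso φ.a := inferInstanceAs (IsIso a)
  have : IsIso φ.b := inferInstanceAs (IsIso b.hom)
  have : IsIso φ.c := inferInstanceAs (IsIso c.hom)
  exact ⟨Tri.isoOfHom φ, rfl, rfl⟩

lemma isIso_b_of_id (hT : D.dist T) (b : T.Y ⟶ T.Y) (h₁ : T.f ≫ b = T.f)
    (h₂ : b ≫ T.g = T.g) : IsIso b := by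
  obtain ⟨s, hs⟩ := IsHomExact.desc₂ T hT (b - 𝟙 _) (by rw [Preadditive.comp_sub, h₁]; simp)
  refine isIso_of_sub_id_sq_zero b ?_
  nth_rw 2 [hs]
  rw [← Category.assoc, Preadditive.sub_comp, h₂]
  simp

/-- Morphisms of distinguished triangles can be completed at the second vertex. -/
lemma fill₂ (hT : D.dist T) (hT' : D.dist T') (a : T.X ⟶ T'.X) (c : T.Z ⟶ T'.Z)
    (comm : T.h ≫ D.susp.map a = c ≫ T'.h) :
    ∃ b : T.Y ⟶ T'.Y, T.f ≫ b = a ≫ T'.f ∧ T.g ≫ c = b ≫ T'.g := by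
  have := IsHomExact.additive (D := D)
  obtain ⟨b, hb⟩ := IsHomExact.lift₃ T' hT' (T.g ≫ c) (by
    rw [Category.assoc, ← comm, ← Category.assoc, IsHomExact.comp₂₃ T hT, zero_comp])
  obtain ⟨a', h₁, h₂⟩ := IsFillable.fill₁ T T' hT hT' b c hb
  -- The pair `(b, c)` completes to some `a'`, not to the given `a`. The error factors through
  -- `T.f`, and it can be absorbed into `b` by a term that `T'.g` kills.
  obtain ⟨s, hs⟩ := IsFillable.desc₁ T hT (a - a') (by
    rw [Functor.map_sub, Preadditive.comp_sub, h₂, comm, sub_self])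
  refine ⟨b + s ≫ T'.f, ?_, ?_⟩
  · rw [Preadditive.comp_add, h₁, ← Category.assoc, ← hs, Preadditive.sub_comp]
    abel
  · rw [Preadditive.add_comp, Category.assoc, IsHomExact.comp₁₂ T' hT', hb]
    simp

/-- A distinguished triangle is determined by its third map. -/
lemma exists_iso_of_h (hT : D.dist T) (hT' : D.dist T') (a : T.X ≅ T'.X) (c : T.Z ≅ T'.Z)
    (comm : T.h ≫ D.susp.map a.hom = c.hom ≫ T'.h) :
    ∃ e : T ≅ T', e.hom.a = a.hom ∧ e.hom.c = c.hom := by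
  obtain ⟨b, h₁, h₂⟩ := fill₂ hT hT' _ _ comm
  obtain ⟨d, h₃, h₄⟩ := fill₂ hT' hT a.inv c.inv (by
    rw [Iso.eq_inv_comp, ← reassoc_of% comm, ← Functor.map_comp]; simp)
  have := isIso_b_of_id hT (b ≫ d) (by rw [reassoc_of% h₁, h₃, a.hom_inv_id_assoc])
    (by rw [Category.assoc, ← h₄, ← reassoc_of% h₂]; simp)
  have := isIso_b_of_id hT' (d ≫ b) (by rw [reassoc_of% h₃, h₁, a.inv_hom_id_assoc])
    (by rw [Category.assoc, ← h₂, ← reassoc_of% h₄]; simp)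
  have := isIso_of_isIso_comp_both b d
  let φ : T ⟶ T' := ⟨a.hom, b, c.hom, h₁, h₂, comm⟩
  have : IsIso φ.a := inferInstanceAs (IsIso a.hom)
  have : IsIso φ.b := inferInstanceAs (IsIso b)
  have : IsIso φ.c := inferInstanceAs (IsIso c.hom)
  exact ⟨Tri.isoOfHom φ, rfl, rfl⟩

end TriangleData

end

/-! ### The completion properties in a pretriangulated category. -/

section Pretriangulated

open Pretriangulated

variable (K : Type u) [Category.{v} K] [Preadditive K] [HasZeroObject K] [HasShift K ℤ]
  [∀ n : ℤ, (shiftFunctor K n).Additive] [Pretriangulated K]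

instance : (ofPretriangulated K).IsFillable where
  of_iso {T T'} e hT := isomorphic_distinguished _ hT _
    (Triangle.isoMk _ _
      ⟨e.inv.a, e.hom.a, Tri.inv_hom_a e, Tri.hom_inv_a e⟩
      ⟨e.inv.b, e.hom.b, Tri.inv_hom_b e, Tri.hom_inv_b e⟩
      ⟨e.inv.c, e.hom.c, Tri.inv_hom_c e, Tri.hom_inv_c e⟩
      e.inv.comm₁ e.inv.comm₂ e.inv.comm₃)
  fill₁ T T' hT hT' b c comm := complete_distinguished_triangle_morphism₁ _ _ hT hT' b c comm
  desc₁ T hT W u hu := by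
    -- The rotated triangle has the suspension of `T.X` as third vertex and minus the suspension of
    -- `T.f` as last map; this is the source of the sign in the witness `-v`.
    obtain ⟨v, hv⟩ := Triangle.yoneda_exact₃ _ (rot_of_distTriang _ hT)
      ((shiftFunctor K (1 : ℤ)).map u) hu
    obtain ⟨v : T.Y ⟶ W, rfl⟩ := (shiftFunctor K (1 : ℤ)).map_surjective v
    refine ⟨-v, (shiftFunctor K (1 : ℤ)).map_injective (hv.trans ?_)⟩
    change (-(shiftFunctor K (1 : ℤ)).map T.f) ≫ (shiftFunctor K (1 : ℤ)).map v =
      (shiftFunctor K (1 : ℤ)).map (T.f ≫ (-v))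
    rw [Functor.map_comp, Functor.map_neg, Preadditive.neg_comp, Preadditive.comp_neg]

end Pretriangulated

end RelStable

/-! ### Diagram lemmas in an exact category. -/

namespace RelStable

namespace ExactStructure

variable {F : Type u} [Category.{v} F] [Preadditive F] [HasZeroObject F] [HasBinaryBiproducts F]
  {S : ExactStructure F}

lemma mono_f {T : ShortComplex F} (hT : S.conflation T) : Mono T.f :=
  ⟨fun _ _ h => Fork.IsLimit.hom_ext (S.kernel T hT).some h⟩

/-- An admissible monomorphism together with a cokernel is a conflation. -/
lemma conflation_of_cokernel {X Y Z : F} {i : X ⟶ Y} {p : Y ⟶ Z} (w : i ≫ p = 0)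
    (hi : S.IsAdmissibleMono i) [Epi p]
    (hp : ∀ {V : F} (m : Y ⟶ V), i ≫ m = 0 → ∃ n, p ≫ n = m) : S.conflation ⟨i, p, w⟩ := by
  obtain ⟨W, p', w', h'⟩ := hi
  have : Epi p' := epi_g h'
  obtain ⟨n, hn⟩ := hp p' w'
  obtain ⟨n', hn'⟩ := exists_desc h' p w
  dsimp only at n' hn'
  let e : W ≅ Z := ⟨n', n,
    by rw [← cancel_epi p', reassoc_of% hn', hn, Category.comp_id],
    by rw [← cancel_epi p, reassoc_of% hn, hn', Category.comp_id]⟩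
  exact S.of_iso (T := ⟨i, p', w'⟩) (T' := ⟨i, p, w⟩)
    (ShortComplex.isoMk (Iso.refl _) (Iso.refl _) e
    ((Category.id_comp _).trans (Category.comp_id _).symm) ((Category.id_comp _).trans hn'.symm)) h'

/-- An admissible epimorphism together with a kernel is a conflation. -/
lemma conflation_of_kernel {X Y Z : F} {i : X ⟶ Y} {p : Y ⟶ Z} (w : i ≫ p = 0)
    (hp : S.IsAdmissibleEpi p) [Mono i]
    (hi : ∀ {V : F} (m : V ⟶ Y), m ≫ p = 0 → ∃ n, n ≫ i = m) : S.conflation ⟨i, p, w⟩ := by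
  obtain ⟨W, i', w', h'⟩ := hp
  have : Mono i' := mono_f h'
  obtain ⟨n, hn⟩ := hi i' w'
  obtain ⟨n', hn'⟩ := exists_lift h' i w
  dsimp only at n' hn'
  let e : W ≅ X := ⟨n, n',
    by rw [← cancel_mono i', Category.assoc, hn', hn, Category.id_comp],
    by rw [← cancel_mono i, Category.assoc, hn, hn', Category.id_comp]⟩
  exact S.of_iso (T := ⟨i', p, w'⟩) (T' := ⟨i, p, w⟩)
    (ShortComplex.isoMk e (Iso.refl _) (Iso.refl _)
    (hn.trans (Category.comp_id _).symm) ((Category.id_comp _).trans (Category.comp_id _).symm)) h'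

variable (S)

lemma isAdmissibleEpi_fst (X Y : F) : S.IsAdmissibleEpi (biprod.fst : X ⊞ Y ⟶ X) :=
  ⟨_, biprod.inr, by simp, S.of_splitting _
    { r := biprod.snd, s := biprod.inl, f_r := by simp, s_g := by simp,
      id := by rw [add_comm]; exact biprod.total }⟩

lemma isAdmissibleMono_inr (X Y : F) : S.IsAdmissibleMono (biprod.inr : Y ⟶ X ⊞ Y) :=
  ⟨_, biprod.fst, by simp, S.of_splitting _
    { r := biprod.snd, s := biprod.inl, f_r := by simp, s_g := by simp,
      id := by rw [add_comm]; exact biprod.total }⟩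

lemma isAdmissibleMono_graph {X Y : F} (a : X ⟶ Y) :
    S.IsAdmissibleMono (biprod.lift (𝟙 X) a) :=
  ⟨_, biprod.desc (-a) (𝟙 Y), by simp, S.of_splitting _
    { r := biprod.fst, s := biprod.inr, f_r := by simp, s_g := by simp,
      id := by dsimp only; ext <;> simp }⟩

lemma isAdmissibleEpi_cograph {X Y : F} (a : X ⟶ Y) :
    S.IsAdmissibleEpi (biprod.desc a (𝟙 Y)) :=
  ⟨_, biprod.lift (𝟙 X) (-a), by simp, S.of_splitting _
    { r := biprod.fst, s := biprod.inr, f_r := by simp, s_g := by simp,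
      id := by dsimp only; ext <;> simp }⟩

variable {S}

/-- The map is a kernel of `biprod.fst ≫ p`, which is a composite of two admissible epimorphisms. -/
lemma isAdmissibleMono_map_id {X Y : F} {i : X ⟶ Y} (hi : S.IsAdmissibleMono i) (X' : F) :
    S.IsAdmissibleMono (biprod.map i (𝟙 X')) := by
  obtain ⟨W, p, w, h⟩ := hi
  have : Mono i := mono_f h
  have : Mono (biprod.map i (𝟙 X')) := ⟨fun a b hab => by
    ext
    · rw [← cancel_mono i]
      simpa using hab =≫ biprod.fst
    · simpa using hab =≫ biprod.snd⟩
  refine ⟨W, biprod.fst ≫ p, by simp [w], conflation_of_kernel _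
    (S.epi_comp _ _ (S.isAdmissibleEpi_fst Y X') ⟨_, i, w, h⟩) fun m hm => ?_⟩
  obtain ⟨n, hn⟩ := exists_lift h (m ≫ biprod.fst) (by simpa using hm)
  exact ⟨biprod.lift n (m ≫ biprod.snd), by dsimp only at hn; ext <;> simp [hn]⟩

/-- If one component is an admissible monomorphism, then so is the morphism to a direct sum. -/
lemma isAdmissibleMono_lift {X Y X' : F} {i : X ⟶ Y} (hi : S.IsAdmissibleMono i) (a : X ⟶ X') :
    S.IsAdmissibleMono (biprod.lift i a) := by
  -- The column `(i, a)` is the graph of `a`, a split monomorphism, followed by `i ⊕ 1`.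
  have := S.mono_comp _ _ (S.isAdmissibleMono_graph a) (isAdmissibleMono_map_id hi X')
  rwa [show biprod.lift (𝟙 X) a ≫ biprod.map i (𝟙 X') = biprod.lift i a by ext <;> simp] at this

/-- Dually, the map is a cokernel of `i ≫ biprod.inr`, a composite of two admissible monomorphisms.
-/
lemma isAdmissibleEpi_map_id {Y Z : F} {p : Y ⟶ Z} (hp : S.IsAdmissibleEpi p) (X' : F) :
    S.IsAdmissibleEpi (biprod.map (𝟙 X') p) := by
  obtain ⟨W, i, w, h⟩ := hp
  have : Epi p := epi_g h
  have : Epi (biprod.map (𝟙 X') p) := ⟨fun a b hab => by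
    ext
    · simpa using biprod.inl ≫= hab
    · rw [← cancel_epi p]
      simpa using biprod.inr ≫= hab⟩
  refine ⟨W, i ≫ biprod.inr, by simp [reassoc_of% w], conflation_of_cokernel _
    (S.mono_comp _ _ ⟨_, p, w, h⟩ (S.isAdmissibleMono_inr X' Y)) fun m hm => ?_⟩
  obtain ⟨n, hn⟩ := exists_desc h (biprod.inr ≫ m) (by simpa using hm)
  exact ⟨biprod.desc (biprod.inl ≫ m) n, by dsimp only at hn; ext <;> simp [hn]⟩

/-- If one component is an admissible epimorphism, then so is the morphism from a direct sum. -/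
lemma isAdmissibleEpi_desc {X Y Z : F} {p : Y ⟶ Z} (hp : S.IsAdmissibleEpi p) (a : X ⟶ Z) :
    S.IsAdmissibleEpi (biprod.desc a p) := by
  have := S.epi_comp _ _ (isAdmissibleEpi_map_id hp X) (S.isAdmissibleEpi_cograph a)
  rwa [show biprod.map (𝟙 X) p ≫ biprod.desc a (𝟙 Z) = biprod.desc a p by ext <;> simp] at this

/-- The pushout of a conflation, with the same third object. -/
lemma exists_pushout_conflation {T : ShortComplex F} (hT : S.conflation T) {X' : F}
    (a : T.X₁ ⟶ X') :
    ∃ (Y' : F) (b : T.X₂ ⟶ Y') (i' : X' ⟶ Y') (p' : Y' ⟶ T.X₃) (w : i' ≫ p' = 0),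
      S.conflation ⟨i', p', w⟩ ∧ IsPushout T.f a b i' ∧ b ≫ p' = T.g := by
  obtain ⟨Y', b, i', sq, hi'⟩ := S.pushout T.f a ⟨_, T.g, T.zero, hT⟩
  have hb := sq.inl_desc T.g (0 : X' ⟶ T.X₃) (by simp [T.zero])
  have hi := sq.inr_desc T.g (0 : X' ⟶ T.X₃) (by simp [T.zero])
  have := epi_g hT
  have : Epi (sq.desc T.g (0 : X' ⟶ T.X₃) (by simp [T.zero])) := epi_of_epi_fac hb
  refine ⟨Y', b, i', _, hi, conflation_of_cokernel hi hi' fun m hm => ?_, sq, hb⟩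
  obtain ⟨n, hn⟩ := exists_desc hT (b ≫ m) (by
    rw [← Category.assoc, sq.w, Category.assoc, hm, comp_zero])
  refine ⟨n, sq.hom_ext ?_ ?_⟩
  · rw [reassoc_of% hb, hn]
  · rw [reassoc_of% hi, zero_comp, hm]

/-- A pushout square with an admissible monomorphism gives a conflation. -/
lemma conflation_of_isPushout {X Y X' Y' : F} {i : X ⟶ Y} {a : X ⟶ X'} {b : Y ⟶ Y'}
    {i' : X' ⟶ Y'} (sq : IsPushout i a b i') (hi : S.IsAdmissibleMono i) :
    ∃ w, S.conflation ⟨biprod.lift i (-a), biprod.desc b i', w⟩ := by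
  have hw : biprod.lift i (-a) ≫ biprod.desc b i' = 0 := by simp [sq.w]
  have : Epi (biprod.desc b i') := ⟨fun m n h => sq.hom_ext
    (by simpa using biprod.inl ≫= h) (by simpa using biprod.inr ≫= h)⟩
  refine ⟨hw, conflation_of_cokernel hw (isAdmissibleMono_lift hi (-a)) fun m hm =>
    ⟨sq.desc (biprod.inl ≫ m) (biprod.inr ≫ m) ?_, ?_⟩⟩
  · rw [← sub_eq_zero, ← hm, biprod.lift_eq]
    simp [sub_eq_add_neg]
  · ext <;> simp

/-- This is the form needed for the relative triangulation, where the morphism `f` comes before the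
preenvelope and the preenvelope carries the sign. The exchange of the summands is taken with sign
`-1`, which is compensated by `-1` on `Y'`. -/
lemma conflation_of_isPushout' {X Y X' Y' : F} {i : X ⟶ Y} {a : X ⟶ X'} {b : Y ⟶ Y'}
    {i' : X' ⟶ Y'} (sq : IsPushout i a b i') (hi : S.IsAdmissibleMono i) :
    ∃ w, S.conflation ⟨biprod.lift a (-i), biprod.desc i' b, w⟩ := by
  obtain ⟨w, h⟩ := conflation_of_isPushout sq hi
  let e : Y ⊞ X' ≅ X' ⊞ Y := ⟨biprod.lift (-biprod.snd) (-biprod.fst),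
    biprod.lift (-biprod.snd) (-biprod.fst), by ext <;> simp, by ext <;> simp⟩
  let e' : Y' ≅ Y' := ⟨-𝟙 _, -𝟙 _, by simp, by simp⟩
  refine ⟨by simp [sq.w], S.of_iso (T := ⟨biprod.lift i (-a), biprod.desc b i', w⟩)
    (ShortComplex.isoMk (Iso.refl _) e e' ?_ ?_) h⟩
  · dsimp [e]
    ext <;> simp
  · dsimp [e, e']
    ext <;> simp

end ExactStructure

end RelStable

namespace RelStable

/-! ### Triangles which are isomorphic to images of conflations -/

namespace Tri

variable {C : Type u} [Category.{v} C] {S : C ⥤ C} {T T' T₀ T₀' : Tri S}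

lemma fill₁_of_iso (e : T₀ ≅ T) (e' : T₀' ≅ T')
    (H : ∀ (b : T₀.Y ⟶ T₀'.Y) (c : T₀.Z ⟶ T₀'.Z), T₀.g ≫ c = b ≫ T₀'.g →
      ∃ a : T₀.X ⟶ T₀'.X, T₀.f ≫ b = a ≫ T₀'.f ∧ T₀.h ≫ S.map a = c ≫ T₀'.h)
    (b : T.Y ⟶ T'.Y) (c : T.Z ⟶ T'.Z) (comm : T.g ≫ c = b ≫ T'.g) :
    ∃ a : T.X ⟶ T'.X, T.f ≫ b = a ≫ T'.f ∧ T.h ≫ S.map a = c ≫ T'.h := by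
  obtain ⟨a, h₁, h₂⟩ := H (e.hom.b ≫ b ≫ e'.inv.b) (e.hom.c ≫ c ≫ e'.inv.c) (by
    rw [← Category.assoc, e.hom.comm₂, Category.assoc, reassoc_of% comm, e'.inv.comm₂]
    simp only [Category.assoc])
  refine ⟨e.inv.a ≫ a ≫ e'.hom.a, ?_, ?_⟩
  · simp only [Category.assoc]
    rw [← e'.hom.comm₁, ← reassoc_of% h₁, f_eq e]
    simp
  · rw [S.map_comp, S.map_comp, ← Category.assoc, e.inv.comm₃, Category.assoc, reassoc_of% h₂,
      e'.hom.comm₃]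
    simp only [← Category.assoc, inv_hom_c, Category.id_comp]

lemma desc₁_of_iso [Preadditive C] (e : T₀ ≅ T) {W : C}
    (H : ∀ u : T₀.X ⟶ W, T₀.h ≫ S.map u = 0 → ∃ v : T₀.Y ⟶ W, u = T₀.f ≫ v)
    (u : T.X ⟶ W) (hu : T.h ≫ S.map u = 0) : ∃ v : T.Y ⟶ W, u = T.f ≫ v := by
  obtain ⟨v, hv⟩ := H (e.hom.a ≫ u) (by
    rw [S.map_comp, ← Category.assoc, e.hom.comm₃, Category.assoc, hu, comp_zero])
  refine ⟨e.inv.b ≫ v, ?_⟩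
  rw [← Category.assoc, e.inv.comm₁, Category.assoc, ← hv, ← Category.assoc, inv_hom_a,
    Category.id_comp]

end Tri

namespace ExactStructure

variable {F : Type u} [Category.{v} F] [Preadditive F] [HasZeroObject F] [HasBinaryBiproducts F]
  {S : ExactStructure F}

namespace IsFrobenius

variable (hS : S.IsFrobenius)

/-- Both composites are induced by extensions of `φ.τ₁ ≫ ι` to `T.X₂`, namely `u ≫ u₁` and `φ.τ₂ ≫
u'`, and stably the induced map does not depend on the extension. Unlike `image_fill`, this concerns
the given third component `φ.τ₃`, so connecting maps can be compared along explicit morphisms of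
conflations. -/
lemma imageTriangle_h_naturality {T T' : ShortComplex F} (hT : S.conflation T)
    (hT' : S.conflation T') (φ : T ⟶ T') :
    (hS.imageTriangle T hT).h ≫ hS.susp.map (S.toStable.map φ.τ₁) =
      S.toStable.map φ.τ₃ ≫ (hS.imageTriangle T' hT').h := by
  obtain ⟨w, u, h, hw, e⟩ := hS.connecting_spec hT
  obtain ⟨w', u', h', hw', e'⟩ := hS.connecting_spec hT'
  obtain ⟨w₁, u₁, h₁, hw₁⟩ := hS.exists_susp φ.τ₁
  rw [e, e']
  refine (congr_arg (S.toStable.map w ≫ ·) (hS.susp_map_eq h₁ hw₁)).trans ?_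
  change S.toStable.map w ≫ S.toStable.map w₁ = S.toStable.map φ.τ₃ ≫ S.toStable.map w'
  rw [← Functor.map_comp, ← Functor.map_comp]
  refine hS.ext_unique hT (a := φ.τ₁) (u := u ≫ u₁) (u' := φ.τ₂ ≫ u') ?_ ?_ ?_ ?_ rfl
  · rw [reassoc_of% h, h₁]
  · rw [← Category.assoc, ← φ.comm₁₂, Category.assoc, h']
  · rw [reassoc_of% hw, hw₁, Category.assoc]
  · rw [← Category.assoc, ← φ.comm₂₃, Category.assoc, hw', Category.assoc]

lemma image_fill₁ {T T' : ShortComplex F} (hT : S.conflation T) (hT' : S.conflation T')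
    (b : (hS.imageTriangle T hT).Y ⟶ (hS.imageTriangle T' hT').Y)
    (c : (hS.imageTriangle T hT).Z ⟶ (hS.imageTriangle T' hT').Z)
    (comm : (hS.imageTriangle T hT).g ≫ c = b ≫ (hS.imageTriangle T' hT').g) :
    ∃ a : (hS.imageTriangle T hT).X ⟶ (hS.imageTriangle T' hT').X,
      (hS.imageTriangle T hT).f ≫ b = a ≫ (hS.imageTriangle T' hT').f ∧
      (hS.imageTriangle T hT).h ≫ hS.susp.map a = c ≫ (hS.imageTriangle T' hT').h := by
  dsimp only [imageTriangle] at b c comm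
  obtain ⟨b, rfl⟩ := S.toStable.map_surjective b
  obtain ⟨c, rfl⟩ := S.toStable.map_surjective c
  rw [← Functor.map_comp, ← Functor.map_comp, map_eq_iff] at comm
  obtain ⟨P, hP, s, t, hst⟩ := comm
  obtain ⟨t', ht'⟩ := hP T' hT' t
  -- The square commutes only modulo a projective object. Lifting the error along `T'.g` and
  -- absorbing it into `b` gives a strictly commutative square, hence a map between the kernels.
  have hb : T.g ≫ c = (b + s ≫ t') ≫ T'.g := by
    rw [Preadditive.add_comp, Category.assoc, ht', ← hst]
    abel
  have hb' : S.toStable.map b = S.toStable.map (b + s ≫ t') := by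
    rw [map_eq_iff]
    exact ⟨P, hP, -s, t', by simp⟩
  obtain ⟨a, ha⟩ := exists_lift hT' (T.f ≫ (b + s ≫ t')) (by
    rw [Category.assoc, ← hb, ← Category.assoc, T.zero, zero_comp])
  refine ⟨S.toStable.map a, ?_, hS.imageTriangle_h_naturality hT hT' ⟨a, _, c, ha, hb.symm⟩⟩
  change S.toStable.map T.f ≫ S.toStable.map b = S.toStable.map a ≫ S.toStable.map T'.f
  rw [hb', ← Functor.map_comp, ← Functor.map_comp, ha]

lemma image_desc₁ {T : ShortComplex F} (hT : S.conflation T) {W : S.Stable}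
    (u : (hS.imageTriangle T hT).X ⟶ W) (hu : (hS.imageTriangle T hT).h ≫ hS.susp.map u = 0) :
    ∃ v : (hS.imageTriangle T hT).Y ⟶ W, u = (hS.imageTriangle T hT).f ≫ v := by
  obtain ⟨W⟩ := W
  obtain ⟨w, j, h, hw, e⟩ := hS.connecting_spec hT
  rw [e] at hu
  dsimp only [imageTriangle] at u hu ⊢
  obtain ⟨u, rfl⟩ := S.toStable.map_surjective u
  obtain ⟨w₁, u₁, h₁, hw₁⟩ := hS.exists_susp u
  replace hu := (congr_arg (S.toStable.map w ≫ ·) (hS.susp_map_eq h₁ hw₁)).symm.trans hu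
  change S.toStable.map w ≫ S.toStable.map w₁ =
    (0 : S.toStable.obj T.X₃ ⟶ S.toStable.obj (hS.cosyzygy W)) at hu
  rw [← Functor.map_comp, map_eq_zero_iff] at hu
  obtain ⟨P, hP, s, t, hst⟩ := hu
  obtain ⟨t', ht'⟩ := hP _ (hS.hullSeq_conflation W) t
  dsimp only at t' ht'
  -- The subtracted term vanishes on `T.f` and corrects `j ≫ u₁` so that it lands in the kernel `W`
  -- of the projection from the hull. On `T.X₁` the corrected map is still `u ≫ ι`, so `T.f ≫ d = u`
  -- holds already in `F`.
  obtain ⟨d, hd⟩ := exists_lift (hS.hullSeq_conflation W) (j ≫ u₁ - T.g ≫ s ≫ t') (by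
    simp only [Preadditive.sub_comp, Category.assoc]
    rw [ht', ← hst, reassoc_of% hw, hw₁, sub_self])
  dsimp only at d hd
  have : Mono (hS.ι W) := mono_f (hS.hullSeq_conflation W)
  refine ⟨S.toStable.map d, ?_⟩
  rw [← Functor.map_comp]
  congr 1
  rw [← cancel_mono (hS.ι W), Category.assoc, hd, Preadditive.comp_sub, reassoc_of% h, h₁,
    ← Category.assoc T.f, T.zero, zero_comp, sub_zero]

instance : hS.stableData.IsFillable where
  of_iso := by
    rintro T T' e ⟨T₀, h₀, ⟨e₀⟩⟩
    exact ⟨T₀, h₀, ⟨e₀ ≪≫ e⟩⟩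
  fill₁ := by
    rintro T T' ⟨T₀, h₀, ⟨e⟩⟩ ⟨T₀', h₀', ⟨e'⟩⟩ b c comm
    exact Tri.fill₁_of_iso e e' (hS.image_fill₁ h₀ h₀') b c comm
  desc₁ := by
    rintro T ⟨T₀, h₀, ⟨e⟩⟩ W u hu
    exact Tri.desc₁_of_iso e (hS.image_desc₁ h₀) u hu

end IsFrobenius

end ExactStructure

end RelStable

/-! ### Models of the stable category. -/

namespace RelStable

section

variable {C : Type u} [Category.{v} C] {C' : Type u'} [Category.{v'} C'] {S : C ⥤ C}
  {S' : C' ⥤ C'} (G : C ⥤ C') (θ : S ⋙ G ≅ G ⋙ S')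

/-- The image of a morphism of triangles. -/
def Tri.mapHom {T T' : Tri S} (φ : T ⟶ T') : T.map G θ ⟶ T'.map G θ where
  a := G.map φ.a
  b := G.map φ.b
  c := G.map φ.c
  comm₁ := by dsimp only [Tri.map]; rw [← G.map_comp, ← G.map_comp, φ.comm₁]
  comm₂ := by dsimp only [Tri.map]; rw [← G.map_comp, ← G.map_comp, φ.comm₂]
  comm₃ := by
    have := θ.hom.naturality φ.a
    dsimp only [Functor.comp_map, Functor.comp_obj, Tri.map] at this ⊢
    rw [Category.assoc, ← this, ← G.map_comp_assoc, φ.comm₃, G.map_comp_assoc]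

/-- The image of an isomorphism of triangles. -/
def Tri.mapIso {T T' : Tri S} (e : T ≅ T') : T.map G θ ≅ T'.map G θ where
  hom := Tri.mapHom G θ e.hom
  inv := Tri.mapHom G θ e.inv
  hom_inv_id := Tri.Hom.ext
    (by simp [Tri.mapHom, ← G.map_comp, Tri.map])
    (by simp [Tri.mapHom, ← G.map_comp, Tri.map])
    (by simp [Tri.mapHom, ← G.map_comp, Tri.map])
  inv_hom_id := Tri.Hom.ext
    (by simp [Tri.mapHom, ← G.map_comp, Tri.map])
    (by simp [Tri.mapHom, ← G.map_comp, Tri.map])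
    (by simp [Tri.mapHom, ← G.map_comp, Tri.map])

end

variable {F : Type u} [Category.{v} F] [Preadditive F] [HasZeroObject F] [HasBinaryBiproducts F]
  {S : ExactStructure F} {K : Type u'} [Category.{v'} K] [Preadditive K]

open ExactStructure

/-- The image of a morphism of conflations in the stable category. -/
noncomputable def ExactStructure.IsFrobenius.imageTriangleMap (hS : S.IsFrobenius)
    {T T' : ShortComplex F} (hT : S.conflation T) (hT' : S.conflation T') (φ : T ⟶ T') :
    hS.imageTriangle T hT ⟶ hS.imageTriangle T' hT' where
  a := S.toStable.map φ.τ₁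
  b := S.toStable.map φ.τ₂
  c := S.toStable.map φ.τ₃
  comm₁ := (S.toStable.map_comp _ _).symm.trans
    ((congr_arg S.toStable.map φ.comm₁₂).symm.trans (S.toStable.map_comp _ _))
  comm₂ := (S.toStable.map_comp _ _).symm.trans
    ((congr_arg S.toStable.map φ.comm₂₃).symm.trans (S.toStable.map_comp _ _))
  comm₃ := hS.imageTriangle_h_naturality hT hT' φ

/-- A functor from a Frobenius category to a category with a suspension and distinguished
triangles, which up to equivalence is the quotient functor to the stable category. -/
structure StableModel (S : ExactStructure F) (D : TriangleData K) where
  ϖ : F ⥤ K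
  full : ϖ.Full
  essSurj : ϖ.EssSurj
  additive : ϖ.Additive
  map_eq_zero_iff : ∀ {X Y : F} (f : X ⟶ Y), ϖ.map f = 0 ↔ FactorsThrough S.IsProjective f
  connecting : ∀ T, S.conflation T → (ϖ.obj T.X₃ ⟶ D.susp.obj (ϖ.obj T.X₁))
  naturality : ∀ {T T' : ShortComplex F} (hT : S.conflation T) (hT' : S.conflation T')
    (φ : T ⟶ T'), connecting T hT ≫ D.susp.map (ϖ.map φ.τ₁) = ϖ.map φ.τ₃ ≫ connecting T' hT'
  dist : ∀ T hT, D.dist ⟨ϖ.map T.f, ϖ.map T.g, connecting T hT⟩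

/-- The quotient functor to the stable category. -/
noncomputable def ExactStructure.IsFrobenius.stableModel (hS : S.IsFrobenius) :
    StableModel S hS.stableData where
  ϖ := S.toStable
  full := inferInstance
  essSurj := inferInstance
  additive := inferInstance
  map_eq_zero_iff := RelStable.map_eq_zero_iff _
  connecting T hT := (hS.imageTriangle T hT).h
  naturality := hS.imageTriangle_h_naturality
  dist T hT := ⟨T, hT, ⟨Iso.refl _⟩⟩

/-- The composition of the quotient functor to the stable category with an equivalence of
triangulated categories. -/
noncomputable def StableModel.ofEquiv {hS : S.IsFrobenius} {D : TriangleData K}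
    (G : TriangleEquiv hS.stableData D) : StableModel S D :=
  have := G.isEquivalence
  -- A `TriangleEquiv` is not assumed additive; additivity follows because an equivalence preserves
  -- products, hence biproducts.
  have : PreservesBinaryBiproducts G.functor :=
    preservesBinaryBiproducts_of_preservesBinaryProducts G.functor
  have : G.functor.Additive := Functor.additive_of_preservesBinaryBiproducts G.functor
  { ϖ := S.toStable ⋙ G.functor
    full := inferInstance
    essSurj := inferInstance
    additive := inferInstance
    map_eq_zero_iff := fun f => by
      rw [← RelStable.map_eq_zero_iff, Functor.comp_map, Functor.map_eq_zero_iff]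
    connecting := fun T hT =>
      G.functor.map (hS.imageTriangle T hT).h ≫ G.commSusp.hom.app (S.toStable.obj T.X₁)
    naturality := fun {T T'} hT hT' φ => by
      exact (Tri.mapHom G.functor G.commSusp (hS.imageTriangleMap hT hT' φ)).comm₃
    dist := fun T hT => (G.dist_iff (hS.imageTriangle T hT)).1 ⟨T, hT, ⟨Iso.refl _⟩⟩ }

section Retract

variable {Sg : K ⥤ K} {E : Tri Sg → Prop} {P Q : K} (s : Q ⟶ P) (r : P ⟶ Q)

/-- It serves two purposes: passing along isomorphisms of `K` to objects that come from `F`, and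
showing that the projectives of the relative exact structure, being summands of `E`-projective
precovers, are `E`-projective. -/
lemma IsEProjective.of_retract (h : s ≫ r = 𝟙 Q) (hP : IsEProjective E P) :
    IsEProjective E Q := by
  intro T hT
  obtain ⟨h₁, h₂, h₃⟩ := hP T hT
  refine ⟨fun a b hab => ?_, fun a => ⟨fun ha => ?_, ?_⟩, fun a => ?_⟩
  · have := @h₁ (r ≫ a) (r ≫ b) (by simpa using r ≫= hab)
    simpa [reassoc_of% h] using s ≫= this
  · obtain ⟨b, hb⟩ := (h₂ (r ≫ a)).1 (by simpa using r ≫= ha)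
    exact ⟨s ≫ b, by simpa [reassoc_of% h] using s ≫= hb⟩
  · rintro ⟨b, rfl⟩
    have := (h₂ (r ≫ b ≫ T.f)).2 ⟨r ≫ b, by simp⟩
    simpa [reassoc_of% h] using s ≫= this
  · obtain ⟨b, hb⟩ := h₃ (r ≫ a)
    exact ⟨s ≫ b, by simpa [reassoc_of% h] using s ≫= hb⟩

lemma IsEInjective.of_retract (h : s ≫ r = 𝟙 Q) (hP : IsEInjective E P) :
    IsEInjective E Q := by
  intro T hT
  obtain ⟨h₁, h₂, h₃⟩ := hP T hT
  refine ⟨fun a b hab => ?_, fun a => ⟨fun ha => ?_, ?_⟩, fun a => ?_⟩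
  · have := @h₁ (a ≫ s) (b ≫ s) (by simpa using hab =≫ s)
    simpa [h] using this =≫ r
  · obtain ⟨b, hb⟩ := (h₂ (a ≫ s)).1 (by simpa using ha =≫ s)
    exact ⟨b ≫ r, by simpa [h] using hb =≫ r⟩
  · rintro ⟨b, rfl⟩
    have := (h₂ ((T.g ≫ b) ≫ s)).2 ⟨b ≫ s, by simp⟩
    simpa [h] using this =≫ r
  · obtain ⟨b, hb⟩ := h₃ (a ≫ s)
    exact ⟨b ≫ r, by simpa [h] using hb =≫ r⟩

end Retract

/-! ### Lifting morphisms and distinguished triangles to the exact category. -/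

namespace StableModel

attribute [instance] StableModel.full StableModel.essSurj StableModel.additive

variable {D : TriangleData K} (M : StableModel S D)

/-- The image of a conflation. -/
abbrev tri (T : ShortComplex F) (hT : S.conflation T) : Tri D.susp :=
  ⟨M.ϖ.map T.f, M.ϖ.map T.g, M.connecting T hT⟩

/-- The image of a morphism of conflations. -/
abbrev triMap {T T' : ShortComplex F} (hT : S.conflation T) (hT' : S.conflation T') (φ : T ⟶ T') :
    M.tri T hT ⟶ M.tri T' hT' where
  a := M.ϖ.map φ.τ₁
  b := M.ϖ.map φ.τ₂
  c := M.ϖ.map φ.τ₃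
  comm₁ := by rw [← Functor.map_comp, ← Functor.map_comp, φ.comm₁₂]
  comm₂ := by rw [← Functor.map_comp, ← Functor.map_comp, φ.comm₂₃]
  comm₃ := M.naturality hT hT' φ

lemma map_eq_iff {X Y : F} (f g : X ⟶ Y) :
    M.ϖ.map f = M.ϖ.map g ↔ FactorsThrough S.IsProjective (f - g) := by
  rw [← M.map_eq_zero_iff, Functor.map_sub, sub_eq_zero]

include M in
-- A lift in `K` suffices: its error in `F` factors through an `S`-projective object, which itself
-- lifts along `T.g`.
lemma exists_lift_of_map {T : ShortComplex F} (hT : S.conflation T) {Q : F} (f : Q ⟶ T.X₃)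
    (v : M.ϖ.obj Q ⟶ M.ϖ.obj T.X₂) (h : v ≫ M.ϖ.map T.g = M.ϖ.map f) :
    ∃ f' : Q ⟶ T.X₂, f' ≫ T.g = f := by
  obtain ⟨v, rfl⟩ := M.ϖ.map_surjective v
  rw [← Functor.map_comp, map_eq_iff] at h
  obtain ⟨P, hP, a, b, hab⟩ := h
  obtain ⟨b', hb'⟩ := hP T hT b
  exact ⟨v - a ≫ b', by rw [Preadditive.sub_comp, Category.assoc, hb', ← hab, sub_sub_cancel]⟩

/-- Dually, the error factors through a projective object; that object is also injective, so the
error extends along `T.f`. -/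
lemma exists_extension_of_map (hS : S.IsFrobenius) {T : ShortComplex F} (hT : S.conflation T)
    {Q : F} (f : T.X₁ ⟶ Q) (v : M.ϖ.obj T.X₂ ⟶ M.ϖ.obj Q) (h : M.ϖ.map T.f ≫ v = M.ϖ.map f) :
    ∃ f' : T.X₂ ⟶ Q, T.f ≫ f' = f := by
  obtain ⟨v, rfl⟩ := M.ϖ.map_surjective v
  rw [← Functor.map_comp, map_eq_iff] at h
  obtain ⟨P, hP, a, b, hab⟩ := h
  obtain ⟨a', ha'⟩ := (hS.projective_iff_injective P).1 hP T hT a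
  exact ⟨v - a' ≫ b, by rw [Preadditive.comp_sub, reassoc_of% ha', ← hab, sub_sub_cancel]⟩

/-- Projective direct summands vanish. -/
noncomputable def biprodFstIso (X : F) {P : F} (hP : S.IsProjective P) :
    M.ϖ.obj (X ⊞ P) ≅ M.ϖ.obj X where
  hom := M.ϖ.map biprod.fst
  inv := M.ϖ.map biprod.inl
  hom_inv_id := by
    rw [← Functor.map_comp, ← M.ϖ.map_id, map_eq_iff]
    exact ⟨P, hP, -biprod.snd, biprod.inr, by ext <;> simp⟩
  inv_hom_id := by rw [← Functor.map_comp]; simp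

/-- Projective direct summands vanish. -/
noncomputable def biprodSndIso (X : F) {P : F} (hP : S.IsProjective P) :
    M.ϖ.obj (P ⊞ X) ≅ M.ϖ.obj X where
  hom := M.ϖ.map biprod.snd
  inv := M.ϖ.map biprod.inr
  hom_inv_id := by
    rw [← Functor.map_comp, ← M.ϖ.map_id, map_eq_iff]
    exact ⟨P, hP, -biprod.fst, biprod.inl, by ext <;> simp⟩
  inv_hom_id := by rw [← Functor.map_comp]; simp

variable [D.IsHomExact] [D.IsFillable]

/-- A distinguished triangle is isomorphic to the image of a conflation whose first object is
prescribed. -/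
lemma exists_conflation_from (hS : S.IsFrobenius) {T : Tri D.susp} (hT : D.dist T) {X : F}
    (α : M.ϖ.obj X ≅ T.X) :
    ∃ (Y Z : F) (i : X ⟶ Y) (p : Y ⟶ Z) (w : i ≫ p = 0) (h : S.conflation ⟨i, p, w⟩)
      (e : M.tri _ h ≅ T), e.hom.a = α.hom := by
  let β := M.ϖ.objObjPreimageIso T.Y
  obtain ⟨j, hj⟩ := M.ϖ.map_surjective (α.hom ≫ T.f ≫ β.inv)
  -- Adding the hull of `X` turns `j` into an admissible monomorphism without changing its image in
  -- `K`.
  obtain ⟨Z, p, w, h⟩ := isAdmissibleMono_lift (hS.ι_mono X) j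
  obtain ⟨e, he, -⟩ := TriangleData.exists_iso_of_f (M.dist _ h) hT α
    (M.biprodSndIso _ (hS.hull_projective X) ≪≫ β) (by
      dsimp only [biprodSndIso, Iso.trans_hom]
      rw [← Functor.map_comp_assoc, biprod.lift_snd, hj]
      simp)
  exact ⟨_, _, _, _, _, h, e, he⟩

/-- A distinguished triangle is isomorphic to the image of a conflation whose last object is
prescribed. -/
lemma exists_conflation_to (hS : S.IsFrobenius) {T : Tri D.susp} (hT : D.dist T) {Z : F}
    (γ : M.ϖ.obj Z ≅ T.Z) :
    ∃ (X Y : F) (i : X ⟶ Y) (p : Y ⟶ Z) (w : i ≫ p = 0) (h : S.conflation ⟨i, p, w⟩)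
      (e : M.tri _ h ≅ T), e.hom.c = γ.hom := by
  let β := M.ϖ.objObjPreimageIso T.Y
  obtain ⟨j, hj⟩ := M.ϖ.map_surjective (β.hom ≫ T.g ≫ γ.inv)
  obtain ⟨Q, q, hQ, hq⟩ := hS.enough_projectives Z
  obtain ⟨X, i, w, h⟩ := isAdmissibleEpi_desc hq j
  obtain ⟨e, -, he⟩ := TriangleData.exists_iso_of_g (M.dist _ h) hT
    (M.biprodFstIso _ hQ ≪≫ β) γ (by
      dsimp only [biprodFstIso, Iso.trans_hom]
      rw [← cancel_epi (M.biprodFstIso _ hQ).inv]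
      dsimp only [biprodFstIso]
      simp only [← Functor.map_comp_assoc, biprod.inl_desc, Category.assoc, hj]
      simp)
  exact ⟨_, _, _, _, _, h, e, he⟩

variable {E : Tri D.susp → Prop} (hE : IsFrobeniusClass D E)

include hE

/-- Closure under homotopy pushouts only yields some triangle of `E` on the given first map;
uniqueness of the cone transfers membership to the triangle at hand. -/
lemma mem_of_iso_f {T T' : Tri D.susp} (hT : E T) (hT' : D.dist T') (a : T.X ≅ T'.X)
    (b : T.Y ≅ T'.Y) (comm : T.f ≫ b.hom = a.hom ≫ T'.f) : E T' := by
  obtain ⟨e, -⟩ := TriangleData.exists_iso_of_f (hE.dist _ hT) hT' a b comm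
  exact hE.of_iso _ _ e hT

/-- A conflation belongs to the class if all `E`-projective objects lift along its second map. -/
lemma mem_of_lifts (hS : S.IsFrobenius) {T : ShortComplex F} (hT : S.conflation T)
    (H : ∀ Q, IsEProjective E (M.ϖ.obj Q) → ∀ f : Q ⟶ T.X₃, ∃ f', f' ≫ T.g = f) :
    E (M.tri T hT) := by
  obtain ⟨P, p, hP, X, f, h, hp⟩ := hE.enough_projectives (M.ϖ.obj T.X₃)
  obtain ⟨A, Q, i, q, w, hA, e, he⟩ := M.exists_conflation_to hS (hE.dist _ hp)
    (Z := T.X₃) (Iso.refl _)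
  have hAE := hE.of_iso _ _ e.symm hp
  have hQ : IsEProjective E (M.ϖ.obj Q) :=
    IsEProjective.of_retract e.hom.b e.inv.b (Tri.hom_inv_b e) hP
  -- Lifting the precover itself suffices: it gives a morphism from the precover conflation to `T`
  -- which is the identity on `T.X₃`.
  obtain ⟨u, hu⟩ := H Q hQ q
  obtain ⟨a, ha⟩ := exists_lift hT (i ≫ u) (by rw [Category.assoc, hu, w])
  obtain ⟨Y', b, i', p', w', hY', sq, hb⟩ := exists_pushout_conflation hA a
  dsimp only at b i' p' w' hY' sq hb
  obtain ⟨w'', hc⟩ := conflation_of_isPushout sq ⟨_, q, w, hA⟩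
  let s : BinaryBicone (M.ϖ.obj Q) (M.ϖ.obj T.X₁) :=
    { pt := M.ϖ.obj (Q ⊞ T.X₁)
      fst := M.ϖ.map biprod.fst
      snd := M.ϖ.map biprod.snd
      inl := M.ϖ.map biprod.inl
      inr := M.ϖ.map biprod.inr
      inl_fst := by rw [← Functor.map_comp]; simp
      inl_snd := by rw [← Functor.map_comp]; simp
      inr_fst := by rw [← Functor.map_comp]; simp
      inr_snd := by rw [← Functor.map_comp]; simp }
  have hs : s.IsBilimit := isBinaryBilimitOfTotal _ (by
    dsimp only [s]
    rw [← M.ϖ.map_comp, ← M.ϖ.map_comp, ← M.ϖ.map_add, biprod.total]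
    exact M.ϖ.map_id _)
  -- A pushout along an admissible monomorphism is a homotopy pushout in `K`, because the square
  -- folds into a conflation.
  have hsq : IsHomotopyCartesian D (M.ϖ.map i) (M.ϖ.map a) (M.ϖ.map b) (M.ϖ.map i') := by
    refine ⟨s, ⟨hs⟩, M.connecting _ hc, ?_⟩
    have h₁ : M.ϖ.map i ≫ M.ϖ.map biprod.inl - M.ϖ.map a ≫ M.ϖ.map biprod.inr =
        M.ϖ.map (biprod.lift i (-a)) := by
      rw [← M.ϖ.map_comp, ← M.ϖ.map_comp, ← M.ϖ.map_sub, biprod.lift_eq, sub_eq_add_neg,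
        Preadditive.neg_comp]
    have h₂ : M.ϖ.map biprod.fst ≫ M.ϖ.map b + M.ϖ.map biprod.snd ≫ M.ϖ.map i' =
        M.ϖ.map (biprod.desc b i') := by
      rw [← M.ϖ.map_comp, ← M.ϖ.map_comp, ← M.ϖ.map_add, biprod.desc_eq]
    dsimp only [s]
    rw [h₁, h₂]
    exact M.dist _ hc
  obtain ⟨Z', g', h', hm⟩ := hE.pushout _ _ _ _ hsq ⟨_, _, _, hAE⟩
  have hY'E : E (M.tri _ hY') :=
    mem_of_iso_f hE hm (M.dist _ hY') (Iso.refl _) (Iso.refl _) (by simp)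
  -- Both `T` and the pushout receive a morphism from the precover conflation with first component
  -- `a` and last component the identity, so their connecting maps agree.
  have n₁ := M.naturality hA hY' ⟨a, b, 𝟙 _, sq.w.symm, by simp [hb]⟩
  have n₂ := M.naturality hA hT ⟨a, u, 𝟙 _, ha, by simp [hu]⟩
  obtain ⟨e', -⟩ := TriangleData.exists_iso_of_h (M.dist _ hY') (M.dist _ hT) (Iso.refl _)
    (Iso.refl _) (by
      dsimp only at n₁ n₂ ⊢
      simpa using n₁.symm.trans n₂)
  exact hE.of_iso _ _ e' hY'E

end StableModel

end RelStable

/-! ### The relative exact structure and its Frobenius property. -/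

namespace RelStable

open ExactStructure

namespace StableModel

variable {F : Type u} [Category.{v} F] [Preadditive F] [HasZeroObject F] [HasBinaryBiproducts F]
  {S : ExactStructure F} {K : Type u'} [Category.{v'} K] [Preadditive K]
  {D : TriangleData K} (M : StableModel S D) (E : Tri D.susp → Prop)

/-- The conflations along whose second map all `E`-projective objects lift. -/
def relativeConflation (T : ShortComplex F) : Prop :=
  S.conflation T ∧ ∀ Q, IsEProjective E (M.ϖ.obj Q) → ∀ f : Q ⟶ T.X₃, ∃ f', f' ≫ T.g = f

variable {E} [D.IsHomExact] [D.IsFillable] (hE : IsFrobeniusClass D E) (hS : S.IsFrobenius)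

include hE hS

/-- The lifting condition serves as the definition because the exact axioms follow from it easily;
this connects it with membership in `E`. -/
lemma relativeConflation_iff_mem (T : ShortComplex F) :
    M.relativeConflation E T ↔ ∃ hT : S.conflation T, E (M.tri T hT) := by
  refine ⟨fun h => ⟨h.1, M.mem_of_lifts hE hS h.1 h.2⟩, fun ⟨hT, h⟩ => ⟨hT, fun Q hQ f => ?_⟩⟩
  obtain ⟨v, hv⟩ := (hQ _ h).2.2 (M.ϖ.map f)
  exact M.exists_lift_of_map hT f v hv

/-- The triangle of the chosen `E`-injective preenvelope is isomorphic to the image of a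
conflation. -/
lemma exists_hull_conflation {X : F} {X' : K} (α : M.ϖ.obj X ≅ X') :
    ∃ (J C : F) (i : X ⟶ J) (p : J ⟶ C) (w : i ≫ p = 0) (h : S.conflation ⟨i, p, w⟩)
      (e : M.tri _ h ≅ hE.hullTri X'), e.hom.a = α.hom ∧ IsEInjective E (M.ϖ.obj J) ∧
        M.relativeConflation E ⟨i, p, w⟩ := by
  obtain ⟨J, C, i, p, w, h, e, he⟩ := M.exists_conflation_from hS (hE.hullTri_dist X') α
  exact ⟨J, C, i, p, w, h, e, he,
    IsEInjective.of_retract e.hom.b e.inv.b (Tri.hom_inv_b e) (hE.hull_injective X'),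
    (M.relativeConflation_iff_mem hE hS _).2 ⟨h, hE.of_iso _ _ e.symm (hE.hullTri_mem X')⟩⟩

lemma exists_projective_conflation (Z : F) :
    ∃ (A P : F) (i : A ⟶ P) (p : P ⟶ Z) (w : i ≫ p = 0),
      IsEProjective E (M.ϖ.obj P) ∧ M.relativeConflation E ⟨i, p, w⟩ := by
  obtain ⟨P, p, hP, X, f, h, hp⟩ := hE.enough_projectives (M.ϖ.obj Z)
  obtain ⟨A, Q, i, q, w, hA, e, he⟩ := M.exists_conflation_to hS (hE.dist _ hp)
    (Z := Z) (Iso.refl _)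
  exact ⟨A, Q, i, q, w, IsEProjective.of_retract e.hom.b e.inv.b (Tri.hom_inv_b e) hP,
    (M.relativeConflation_iff_mem hE hS _).2 ⟨hA, hE.of_iso _ _ e.symm hp⟩⟩

/-- The conflations along whose first map all morphisms to `E`-injective objects extend. -/
lemma relativeConflation_iff_extends (T : ShortComplex F) :
    M.relativeConflation E T ↔ S.conflation T ∧
      ∀ Q, IsEInjective E (M.ϖ.obj Q) → ∀ f : T.X₁ ⟶ Q, ∃ f', T.f ≫ f' = f := by
  constructor
  · intro h
    obtain ⟨hT, h⟩ := (M.relativeConflation_iff_mem hE hS T).1 h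
    refine ⟨hT, fun Q hQ f => ?_⟩
    obtain ⟨v, hv⟩ := (hQ _ h).2.2 (M.ϖ.map f)
    exact M.exists_extension_of_map hS hT f v hv
  · rintro ⟨hT, h⟩
    refine ⟨hT, fun Q hQ f => ?_⟩
    obtain ⟨J, C, i, p, w, hi, -, -, hJ, hi'⟩ :=
      M.exists_hull_conflation hE hS (Iso.refl (M.ϖ.obj T.X₁))
    -- Extending the preenvelope gives a morphism from `T` to the preenvelope conflation which is
    -- the identity on `T.X₁`. Hence the connecting map of `T` is `c` followed by that of the
    -- preenvelope.
    obtain ⟨u, hu⟩ := h J hJ i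
    obtain ⟨c, hc⟩ := exists_desc hT (u ≫ p) (by rw [reassoc_of% hu, w])
    obtain ⟨f', hf'⟩ := hi'.2 Q hQ (f ≫ c)
    dsimp only at f' hf'
    have n := M.naturality hT hi ⟨𝟙 _, u, c, by simp [hu], by simp [hc]⟩
    dsimp only at n
    rw [M.ϖ.map_id, D.susp.map_id, Category.comp_id] at n
    have z : M.ϖ.map p ≫ M.connecting _ hi = 0 := TriangleData.IsHomExact.comp₂₃ _ (M.dist _ hi)
    -- The obstruction to lifting `f` is its composite with the connecting map. It vanishes since `f
    -- ≫ c` factors through `p`, after which the connecting map of the preenvelope is zero.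
    obtain ⟨v, hv⟩ := TriangleData.IsHomExact.lift₃ _ (M.dist _ hT) (M.ϖ.map f) (by
      dsimp only
      rw [n, ← M.ϖ.map_comp_assoc, ← hf', M.ϖ.map_comp, Category.assoc, z, comp_zero])
    exact M.exists_lift_of_map hT f v hv.symm

/-- The exact structure given by a Frobenius class of triangles in the stable category. -/
def relativeStructure : ExactStructure F where
  conflation := M.relativeConflation E
  of_iso {T T'} e h := by
    refine ⟨S.of_iso e h.1, fun Q hQ f => ?_⟩
    obtain ⟨f', hf'⟩ := h.2 Q hQ (f ≫ e.inv.τ₃)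
    refine ⟨f' ≫ e.hom.τ₂, ?_⟩
    rw [Category.assoc, e.hom.comm₂₃, reassoc_of% hf', ← ShortComplex.comp_τ₃, e.inv_hom_id,
      ShortComplex.id_τ₃, Category.comp_id]
  of_splitting T s := ⟨S.of_splitting T s, fun Q hQ f => ⟨f ≫ s.s, by simp⟩⟩
  kernel T h := S.kernel T h.1
  cokernel T h := S.cokernel T h.1
  mono_comp {X Y Z} i j := by
    rintro ⟨W, p, w, h⟩ ⟨W', p', w', h'⟩
    -- For the axioms about admissible monomorphisms, the extension condition is the one that
    -- visibly composes and passes to pushouts.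
    rw [M.relativeConflation_iff_extends hE hS] at h h'
    obtain ⟨V, q, z, hq⟩ := S.mono_comp i j ⟨_, _, _, h.1⟩ ⟨_, _, _, h'.1⟩
    refine ⟨V, q, z, (M.relativeConflation_iff_extends hE hS _).2 ⟨hq, fun Q hQ f => ?_⟩⟩
    obtain ⟨a, ha⟩ := h.2 Q hQ f
    obtain ⟨b, hb⟩ := h'.2 Q hQ a
    exact ⟨b, by dsimp only at ha hb ⊢; rw [Category.assoc, hb, ha]⟩
  epi_comp {X Y Z} p q := by
    rintro ⟨W, i, w, h⟩ ⟨W', i', w', h'⟩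
    obtain ⟨V, j, z, hj⟩ := S.epi_comp p q ⟨_, _, _, h.1⟩ ⟨_, _, _, h'.1⟩
    refine ⟨V, j, z, hj, fun Q hQ f => ?_⟩
    obtain ⟨a, ha⟩ := h'.2 Q hQ f
    obtain ⟨b, hb⟩ := h.2 Q hQ a
    exact ⟨b, by dsimp only at ha hb ⊢; rw [reassoc_of% hb, ha]⟩
  pushout {X Y X'} i a := by
    rintro ⟨W, p, w, h⟩
    rw [M.relativeConflation_iff_extends hE hS] at h
    obtain ⟨Y', b, i', sq, V, q, z, hq⟩ := S.pushout i a ⟨_, _, _, h.1⟩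
    refine ⟨Y', b, i', sq, V, q, z,
      (M.relativeConflation_iff_extends hE hS _).2 ⟨hq, fun Q hQ f => ?_⟩⟩
    obtain ⟨c, hc⟩ := h.2 Q hQ (a ≫ f)
    exact ⟨sq.desc c f hc, sq.inr_desc _ _ _⟩
  pullback {Y Z Z'} p a := by
    rintro ⟨W, i, w, h⟩
    obtain ⟨Y', b, p', sq, V, j, z, hj⟩ := S.pullback p a ⟨_, _, _, h.1⟩
    refine ⟨Y', b, p', sq, V, j, z, hj, fun Q hQ f => ?_⟩
    obtain ⟨c, hc⟩ := h.2 Q hQ (f ≫ a)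
    exact ⟨sq.lift c f hc, sq.lift_snd _ _ _⟩

/-- One direction is built into the definition of the conflations. In the other, a relative
projective splits its precover conflation and is thus a summand of an `E`-projective object in `K`.
-/
lemma isProjective_relativeStructure_iff (Q : F) :
    (M.relativeStructure hE hS).IsProjective Q ↔ IsEProjective E (M.ϖ.obj Q) := by
  refine ⟨fun h => ?_, fun h T hT f => hT.2 Q h f⟩
  obtain ⟨A, P, i, p, w, hP, hi⟩ := M.exists_projective_conflation hE hS Q
  obtain ⟨s, hs⟩ := h _ hi (𝟙 Q)
  refine IsEProjective.of_retract (M.ϖ.map s) (M.ϖ.map p) ?_ hP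
  rw [← M.ϖ.map_comp, ← M.ϖ.map_id]
  exact congr_arg _ hs

lemma isInjective_relativeStructure_iff (Q : F) :
    (M.relativeStructure hE hS).IsInjective Q ↔ IsEInjective E (M.ϖ.obj Q) := by
  refine ⟨fun h => ?_,
    fun h T hT f => ((M.relativeConflation_iff_extends hE hS T).1 hT).2 Q h f⟩
  obtain ⟨J, C, i, p, w, -, -, -, hJ, hi⟩ :=
    M.exists_hull_conflation hE hS (Iso.refl (M.ϖ.obj Q))
  obtain ⟨r, hr⟩ := h _ hi (𝟙 Q)
  refine IsEInjective.of_retract (M.ϖ.map i) (M.ϖ.map r) ?_ hJ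
  rw [← M.ϖ.map_comp, ← M.ϖ.map_id]
  exact congr_arg _ hr

lemma isFrobenius_relativeStructure : (M.relativeStructure hE hS).IsFrobenius where
  enough_projectives X := by
    obtain ⟨A, P, i, p, w, hP, hi⟩ := M.exists_projective_conflation hE hS X
    exact ⟨P, p, (M.isProjective_relativeStructure_iff hE hS P).2 hP, A, i, w, hi⟩
  enough_injectives X := by
    obtain ⟨J, C, i, p, w, -, -, -, hJ, hi⟩ :=
      M.exists_hull_conflation hE hS (Iso.refl (M.ϖ.obj X))
    exact ⟨J, i, (M.isInjective_relativeStructure_iff hE hS J).2 hJ, C, p, w, hi⟩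
  projective_iff_injective X := by
    rw [M.isProjective_relativeStructure_iff, M.isInjective_relativeStructure_iff]
    exact hE.projective_iff_injective _

end StableModel

end RelStable

/-! ### The comparison functor and the comparison of suspensions. -/

namespace RelStable

open ExactStructure

namespace IsFrobeniusClass

variable {K : Type u} [Category.{v} K] [Preadditive K] {D : TriangleData K} [D.IsHomExact]
  {E : Tri D.susp → Prop} (hE : IsFrobeniusClass D E)

include hE

/-- Morphisms extend to morphisms of triangles of the class, if the middle term of the second
triangle is injective. -/
lemma exists_hom {T T' : Tri D.susp} (hT : E T) (hT' : E T') (hJ : IsEInjective E T'.Y)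
    (a : T.X ⟶ T'.X) : ∃ φ : T ⟶ T', φ.a = a := by
  obtain ⟨u, hu⟩ := (hJ _ hT).2.2 (a ≫ T'.f)
  obtain ⟨w, hw, hw'⟩ := TriangleData.IsHomExact.fill _ _ (hE.dist _ hT) (hE.dist _ hT') a u hu
  exact ⟨⟨a, u, w, hu, hw, hw'⟩, rfl⟩

variable [HasZeroObject K] [HasBinaryBiproducts K]

/-- The third component of a morphism of triangles of the class is determined by the first one,
in the relative stable category. -/
lemma map_c_eq {T T' : Tri D.susp} (hT : E T) (hT' : E T') (hJ : IsEInjective E T'.Y)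
    (φ φ' : T ⟶ T') (h : (toRelative E).map φ.a = (toRelative E).map φ'.a) :
    (toRelative E).map φ.c = (toRelative E).map φ'.c := by
  have := TriangleData.IsHomExact.additive (D := D)
  rw [map_eq_iff] at h ⊢
  obtain ⟨P, hP, b, c, hbc⟩ := h
  obtain ⟨b', hb'⟩ := (((hE.projective_iff_injective P).1 hP) _ hT).2.2 b
  dsimp only at hb'
  have z₁ := TriangleData.IsHomExact.comp₁₂ _ (hE.dist _ hT')
  have z₂ := TriangleData.IsHomExact.comp₂₃ _ (hE.dist _ hT')
  have z₃ := TriangleData.IsHomExact.comp₃₁ _ (hE.dist _ hT)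
  -- Three corrections follow. The difference of the middle components equals `T.g ≫ t` up to the
  -- term coming from `φ.a - φ'.a`. The difference of the third components then equals `t ≫ T'.g` up
  -- to `T.h ≫ s`. Finally `T'.h` kills `T.h ≫ s`, which is therefore `r ≫ T'.g`. So the whole
  -- difference factors through the injective object `T'.Y`.
  obtain ⟨t, ht⟩ := TriangleData.IsHomExact.desc₂ _ (hE.dist _ hT)
      (φ.b - φ'.b - b' ≫ c ≫ T'.f) (by
    rw [Preadditive.comp_sub, Preadditive.comp_sub, φ.comm₁, φ'.comm₁, reassoc_of% hb',
      ← Preadditive.sub_comp, hbc, Category.assoc, sub_self])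
  have hu : φ.b = φ'.b + b' ≫ c ≫ T'.f + T.g ≫ t := by
    rw [← ht]
    abel
  obtain ⟨s, hs⟩ := TriangleData.IsHomExact.desc₃ _ (hE.dist _ hT) (φ.c - φ'.c - t ≫ T'.g) (by
    rw [Preadditive.comp_sub, Preadditive.comp_sub, φ.comm₂, φ'.comm₂, hu]
    simp [Preadditive.add_comp, z₁])
  obtain ⟨r, hr⟩ := TriangleData.IsHomExact.lift₃ _ (hE.dist _ hT') (T.h ≫ s) (by
    rw [← hs, Preadditive.sub_comp, Preadditive.sub_comp, ← φ.comm₃, ← φ'.comm₃,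
      ← Preadditive.comp_sub, ← D.susp.map_sub, hbc, ← hb']
    simp only [Functor.map_comp, Category.assoc, z₂, comp_zero, sub_zero]
    rw [reassoc_of% z₃, zero_comp])
  refine ⟨_, (hE.projective_iff_injective _).2 hJ, t + r, T'.g, ?_⟩
  rw [Preadditive.add_comp, ← hr, ← hs]
  abel

/-- A morphism `ψ` over the inverse of `φ.a` gives the inverse: both composites have identity first
component, so `map_c_eq` identifies their third components with identities. -/
lemma isIso_map_c {T T' : Tri D.susp} (hT : E T) (hT' : E T') (hJ : IsEInjective E T.Y)
    (hJ' : IsEInjective E T'.Y) (φ : T ⟶ T') [IsIso φ.a] : IsIso ((toRelative E).map φ.c) := by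
  obtain ⟨ψ, hψ⟩ := hE.exists_hom hT' hT hJ (inv φ.a)
  refine ⟨(toRelative E).map ψ.c, ?_, ?_⟩
  · rw [← Functor.map_comp, ← (toRelative E).map_id]
    exact hE.map_c_eq hT hT hJ (φ ≫ ψ) (𝟙 T) (by simp [hψ])
  · rw [← Functor.map_comp, ← (toRelative E).map_id]
    exact hE.map_c_eq hT' hT' hJ' (ψ ≫ φ) (𝟙 T') (by simp [hψ])

lemma relativeData_dist_of_iso {T T' : Tri hE.susp} (e : T ≅ T') (h : hE.relativeData.dist T) :
    hE.relativeData.dist T' := by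
  obtain ⟨X, Y, Z, f, g, k, h, h₁, h₂, h₃, ⟨e'⟩⟩ := h
  exact ⟨X, Y, Z, f, g, k, h, h₁, h₂, h₃, ⟨e' ≪≫ e⟩⟩

end IsFrobeniusClass

namespace StableModel

variable {F : Type u} [Category.{v} F] [Preadditive F] [HasZeroObject F] [HasBinaryBiproducts F]
  {S : ExactStructure F} {K : Type u'} [Category.{v'} K] [Preadditive K]
  [HasZeroObject K] [HasBinaryBiproducts K]
  {D : TriangleData K} [D.IsHomExact] [D.IsFillable] (M : StableModel S D)
  {E : Tri D.susp → Prop} (hE : IsFrobeniusClass D E) (hS : S.IsFrobenius)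

/-- The comparison of stable categories. -/
def relativeFunctor : (M.relativeStructure hE hS).Stable ⥤ Relative E :=
  CategoryTheory.Quotient.lift _ (M.ϖ ⋙ toRelative E) (fun X Y a b hab => by
    obtain ⟨Q, hQ, s, t, hst⟩ := hab
    rw [Functor.comp_map, Functor.comp_map, RelStable.map_eq_iff, ← M.ϖ.map_sub, hst,
      M.ϖ.map_comp]
    exact ⟨_, (M.isProjective_relativeStructure_iff hE hS Q).1 hQ, _, _, rfl⟩)

instance : (M.relativeFunctor hE hS).Full where
  map_surjective {X Y} f := by
    obtain ⟨f, rfl⟩ := (toRelative E).map_surjective f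
    obtain ⟨f, rfl⟩ := M.ϖ.map_surjective f
    exact ⟨(M.relativeStructure hE hS).toStable.map f, rfl⟩

/-- A factorization through an `E`-projective object of `K` lifts to `F` up to a morphism killed by
`M.ϖ`, that is, one through an `S`-projective object. Such an object is projective for the relative
structure too, as the latter has fewer conflations. -/
instance : (M.relativeFunctor hE hS).Faithful where
  map_injective {X Y} f g h := by
    obtain ⟨X⟩ := X
    obtain ⟨Y⟩ := Y
    obtain ⟨f, rfl⟩ := (M.relativeStructure hE hS).toStable.map_surjective f
    obtain ⟨g, rfl⟩ := (M.relativeStructure hE hS).toStable.map_surjective g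
    replace h : (toRelative E).map (M.ϖ.map f) = (toRelative E).map (M.ϖ.map g) := h
    rw [RelStable.map_eq_iff] at h
    obtain ⟨Q, hQ, s, t, hst⟩ := h
    let γ := M.ϖ.objObjPreimageIso Q
    obtain ⟨s', hs'⟩ := M.ϖ.map_surjective (s ≫ γ.inv)
    obtain ⟨t', ht'⟩ := M.ϖ.map_surjective (γ.hom ≫ t)
    have h : M.ϖ.map (f - g - s' ≫ t') = 0 := by
      rw [M.ϖ.map_sub, M.ϖ.map_sub, hst, M.ϖ.map_comp, hs', ht']
      simp
    rw [M.map_eq_zero_iff] at h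
    obtain ⟨P, hP, x, y, hxy⟩ := h
    have h₁ : FactorsThrough (M.relativeStructure hE hS).IsProjective (s' ≫ t') :=
      ⟨_, (M.isProjective_relativeStructure_iff hE hS _).2
        (IsEProjective.of_retract γ.hom γ.inv γ.hom_inv_id hQ), s', t', rfl⟩
    have h₂ : FactorsThrough (M.relativeStructure hE hS).IsProjective (x ≫ y) :=
      ⟨P, fun T hT => hP T hT.1, x, y, rfl⟩
    rw [RelStable.map_eq_iff]
    convert h₁.add h₂ using 1
    rw [← hxy]
    abel

instance : (M.relativeFunctor hE hS).EssSurj where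
  mem_essImage X := ⟨⟨M.ϖ.objPreimage X.as⟩,
    ⟨(toRelative E).mapIso (M.ϖ.objObjPreimageIso X.as)⟩⟩

lemma exists_hullComparison (X : F) :
    ∃ φ : M.tri _ ((M.isFrobenius_relativeStructure hE hS).hullSeq_conflation X).1 ⟶
      hE.hullTri (M.ϖ.obj X), φ.a = 𝟙 _ :=
  hE.exists_hom ((M.relativeConflation_iff_mem hE hS _).1
    ((M.isFrobenius_relativeStructure hE hS).hullSeq_conflation X)).2 (hE.hullTri_mem _)
    (hE.hull_injective _) _

/-- The comparison of the chosen preenvelopes of `X`. -/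
noncomputable def hullComparison (X : F) :
    M.tri _ ((M.isFrobenius_relativeStructure hE hS).hullSeq_conflation X).1 ⟶
      hE.hullTri (M.ϖ.obj X) :=
  (M.exists_hullComparison hE hS X).choose

@[simp]
lemma hullComparison_a (X : F) : (M.hullComparison hE hS X).a = 𝟙 _ :=
  (M.exists_hullComparison hE hS X).choose_spec

lemma mem_hull (X : F) :
    E (M.tri _ ((M.isFrobenius_relativeStructure hE hS).hullSeq_conflation X).1) :=
  ((M.relativeConflation_iff_mem hE hS _).1
    ((M.isFrobenius_relativeStructure hE hS).hullSeq_conflation X)).2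

lemma isIso_map_hullComparison_c (X : F) :
    IsIso ((toRelative E).map (M.hullComparison hE hS X).c) := by
  have : IsIso (M.hullComparison hE hS X).a := by
    rw [hullComparison_a]
    exact IsIso.id _
  exact hE.isIso_map_c (M.mem_hull hE hS X) (hE.hullTri_mem _)
    ((M.isInjective_relativeStructure_iff hE hS _).1
      ((M.isFrobenius_relativeStructure hE hS).hull_injective X)) (hE.hull_injective _) _

/-- The chosen morphism of triangles which extends `a`. -/
lemma exists_extHom {X Y : K} (a : X ⟶ Y) :
    ∃ φ : hE.hullTri X ⟶ hE.hullTri Y, φ.a = a ∧ φ.c = hE.ext a := by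
  obtain ⟨u, h₁, h₂, h₃⟩ := hE.ext_spec a
  exact ⟨⟨a, u, _, h₁, h₂, h₃⟩, rfl, rfl⟩

/-- Both sides are third components of morphisms of triangles in `E` with the same first component,
ending in the triangle of an injective preenvelope, so `map_c_eq` applies. -/
lemma hullComparison_naturality {X Y : F} (a : X ⟶ Y) :
    (toRelative E).map (M.ϖ.map ((M.isFrobenius_relativeStructure hE hS).ext
        ((M.isFrobenius_relativeStructure hE hS).hullSeq_conflation X) a)) ≫
      (toRelative E).map (M.hullComparison hE hS Y).c =
    (toRelative E).map (M.hullComparison hE hS X).c ≫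
      (toRelative E).map (hE.ext (M.ϖ.map a)) := by
  obtain ⟨u, h, hw⟩ := (M.isFrobenius_relativeStructure hE hS).ext_spec
    ((M.isFrobenius_relativeStructure hE hS).hullSeq_conflation X) a
  obtain ⟨φ, hφ, hφ'⟩ := exists_extHom hE (M.ϖ.map a)
  rw [← Functor.map_comp, ← Functor.map_comp, ← hφ']
  refine hE.map_c_eq (M.mem_hull hE hS X) (hE.hullTri_mem _) (hE.hull_injective _)
    (M.triMap _ _ ⟨a, u, _, h.symm, hw.symm⟩ ≫ M.hullComparison hE hS Y)
    (M.hullComparison hE hS X ≫ φ) ?_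
  congr 1
  simp [hφ]

/-- The comparison of the suspension functors. The sign is the usual one between triangles
from conflations and triangles from cones. -/
noncomputable def relativeCommSusp :
    (M.isFrobenius_relativeStructure hE hS).stableData.susp ⋙ M.relativeFunctor hE hS ≅
      M.relativeFunctor hE hS ⋙ hE.relativeData.susp :=
  CategoryTheory.Quotient.natIsoLift _ (NatIso.ofComponents
    (fun X =>
      { hom := -(toRelative E).map (M.hullComparison hE hS X).c
        inv := -(@asIso _ _ _ _ _ (M.isIso_map_hullComparison_c hE hS X)).inv
        hom_inv_id := (Preadditive.neg_comp_neg _ _).trans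
          (@asIso _ _ _ _ _ (M.isIso_map_hullComparison_c hE hS X)).hom_inv_id
        inv_hom_id := (Preadditive.neg_comp_neg _ _).trans
          (@asIso _ _ _ _ _ (M.isIso_map_hullComparison_c hE hS X)).inv_hom_id })
    (fun {X Y} a => ((Preadditive.comp_neg _ _).trans
      (congr_arg Neg.neg (M.hullComparison_naturality hE hS a))).trans
        (Preadditive.neg_comp _ _).symm))

end StableModel

end RelStable

/-! ### Cones, and the comparison of distinguished triangles. -/

namespace RelStable

open ExactStructure

section

variable {C : Type u} [Category.{v} C] {C' : Type u'} [Category.{v'} C'] {S : C ⥤ C}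
  {S' : C' ⥤ C'} (G : C ⥤ C') (θ : S ⋙ G ≅ G ⋙ S') [G.Full] [G.Faithful]

/-- The preimage of a morphism of triangles. -/
noncomputable def Tri.preimageHom {T T' : Tri S} (φ : T.map G θ ⟶ T'.map G θ) : T ⟶ T' where
  a := G.preimage (X := T.X) (Y := T'.X) φ.a
  b := G.preimage (X := T.Y) (Y := T'.Y) φ.b
  c := G.preimage (X := T.Z) (Y := T'.Z) φ.c
  comm₁ := G.map_injective ((G.map_comp _ _).trans
    ((congr_arg (G.map T.f ≫ ·) (G.map_preimage _)).trans (φ.comm₁.trans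
      ((congr_arg (· ≫ G.map T'.f) (G.map_preimage _)).symm.trans (G.map_comp _ _).symm))))
  comm₂ := G.map_injective ((G.map_comp _ _).trans
    ((congr_arg (G.map T.g ≫ ·) (G.map_preimage _)).trans (φ.comm₂.trans
      ((congr_arg (· ≫ G.map T'.g) (G.map_preimage _)).symm.trans (G.map_comp _ _).symm))))
  comm₃ := G.map_injective (by
    have h : (G.map T.h ≫ θ.hom.app T.X) ≫ S'.map φ.a =
      φ.c ≫ G.map T'.h ≫ θ.hom.app T'.X := φ.comm₃
    have n : G.map (S.map (G.preimage (X := T.X) (Y := T'.X) φ.a)) ≫ θ.hom.app T'.X =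
        θ.hom.app T.X ≫ S'.map φ.a :=
      (θ.hom.naturality _).trans (congr_arg (θ.hom.app T.X ≫ S'.map ·) (G.map_preimage _))
    rw [← cancel_mono (θ.hom.app T'.X), G.map_comp, G.map_comp]
    refine (Category.assoc _ _ _).trans ((congr_arg (G.map T.h ≫ ·) n).trans ?_)
    exact (Category.assoc _ _ _).symm.trans (h.trans ((Category.assoc _ _ _).trans
      (congr_arg (· ≫ G.map T'.h ≫ θ.hom.app T'.X) (G.map_preimage _))).symm))

/-- The preimage of an isomorphism of triangles. -/
noncomputable def Tri.preimageIso {T T' : Tri S} (e : T.map G θ ≅ T'.map G θ) : T ≅ T' where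
  hom := Tri.preimageHom G θ e.hom
  inv := Tri.preimageHom G θ e.inv
  hom_inv_id := Tri.Hom.ext
    (G.map_injective ((G.map_comp _ _).trans
      ((congr_arg₂ (· ≫ ·) (G.map_preimage _) (G.map_preimage _)).trans
        ((Tri.hom_inv_a e).trans (G.map_id _).symm))))
    (G.map_injective ((G.map_comp _ _).trans
      ((congr_arg₂ (· ≫ ·) (G.map_preimage _) (G.map_preimage _)).trans
        ((Tri.hom_inv_b e).trans (G.map_id _).symm))))
    (G.map_injective ((G.map_comp _ _).trans
      ((congr_arg₂ (· ≫ ·) (G.map_preimage _) (G.map_preimage _)).trans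
        ((Tri.hom_inv_c e).trans (G.map_id _).symm))))
  inv_hom_id := Tri.Hom.ext
    (G.map_injective ((G.map_comp _ _).trans
      ((congr_arg₂ (· ≫ ·) (G.map_preimage _) (G.map_preimage _)).trans
        ((Tri.inv_hom_a e).trans (G.map_id _).symm))))
    (G.map_injective ((G.map_comp _ _).trans
      ((congr_arg₂ (· ≫ ·) (G.map_preimage _) (G.map_preimage _)).trans
        ((Tri.inv_hom_b e).trans (G.map_id _).symm))))
    (G.map_injective ((G.map_comp _ _).trans
      ((congr_arg₂ (· ≫ ·) (G.map_preimage _) (G.map_preimage _)).trans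
        ((Tri.inv_hom_c e).trans (G.map_id _).symm))))

end

namespace StableModel

variable {F : Type u} [Category.{v} F] [Preadditive F] [HasZeroObject F] [HasBinaryBiproducts F]
  {S : ExactStructure F} {K : Type u'} [Category.{v'} K] [Preadditive K]
  {D : TriangleData K} [D.IsHomExact] [D.IsFillable] (M : StableModel S D)
  {E : Tri D.susp → Prop} (hE : IsFrobeniusClass D E) (hS : S.IsFrobenius)

/-- The pushout of a conflation along `f : X ⟶ Y`, where the image of the conflation is the triangle
of the chosen `E`-injective preenvelope of an object `X'` isomorphic to the image of `X`. -/
structure PushoutCone {X Y : F} (f : X ⟶ Y) {X' : K} (α : M.ϖ.obj X ≅ X') where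
  {J C Z : F}
  i : X ⟶ J
  p : J ⟶ C
  k : J ⟶ Z
  g : Y ⟶ Z
  q : Z ⟶ C
  injective : IsEInjective E (M.ϖ.obj J)
  i_p : i ≫ p = 0
  conf : S.conflation ⟨i, p, i_p⟩
  e : M.tri _ conf ≅ hE.hullTri X'
  e_a : e.hom.a = α.hom
  sq : IsPushout i f k g
  k_q : k ≫ q = p
  g_q : g ≫ q = 0
  conf_q : S.conflation ⟨g, q, g_q⟩
  zero : biprod.lift f (-i) ≫ biprod.desc g k = 0
  cone : M.relativeConflation E ⟨biprod.lift f (-i), biprod.desc g k, zero⟩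

include hS in
lemma nonempty_pushoutCone {X Y : F} (f : X ⟶ Y) {X' : K} (α : M.ϖ.obj X ≅ X') :
    Nonempty (M.PushoutCone hE f α) := by
  obtain ⟨J, C, i, p, w, h, e, he, hJ, h'⟩ := M.exists_hull_conflation hE hS α
  obtain ⟨Z, k, g, q, w', hq, sq, hk⟩ := exists_pushout_conflation h f
  obtain ⟨w'', hc⟩ := conflation_of_isPushout' sq ⟨_, _, _, h⟩
  refine ⟨⟨i, p, k, g, q, hJ, w, h, e, he, sq, hk, w', hq, w'',
    (M.relativeConflation_iff_extends hE hS _).2 ⟨hc, fun Q hQ a => ?_⟩⟩⟩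
  obtain ⟨b, hb⟩ := ((M.relativeConflation_iff_extends hE hS _).1 h').2 Q hQ a
  -- An extension of `a` along `c.i` alone suffices; the sign undoes the one in `biprod.lift f
  -- (-i)`.
  exact ⟨biprod.desc 0 (-b), by simpa using hb⟩

lemma isIso_map_fst [HasZeroObject K] [HasBinaryBiproducts K] (Y : F) {J : F}
    (hJ : IsEProjective E (M.ϖ.obj J)) :
    IsIso ((toRelative E).map (M.ϖ.map (biprod.fst : Y ⊞ J ⟶ Y))) := by
  refine ⟨(toRelative E).map (M.ϖ.map biprod.inl), ?_, ?_⟩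
  · rw [← Functor.map_comp, ← M.ϖ.map_comp, ← (toRelative E).map_id, RelStable.map_eq_iff]
    refine ⟨_, hJ, -M.ϖ.map biprod.snd, M.ϖ.map biprod.inr, ?_⟩
    rw [← M.ϖ.map_neg, ← M.ϖ.map_comp, ← M.ϖ.map_id, ← M.ϖ.map_sub]
    congr 1
    ext <;> simp
  · rw [← Functor.map_comp, ← M.ϖ.map_comp, biprod.inl_fst, M.ϖ.map_id, (toRelative E).map_id]

variable {M hE} {X Y : F} {f : X ⟶ Y}

namespace PushoutCone

/-- The conflation given by a pushout square. -/
noncomputable abbrev seq {X' : K} {α : M.ϖ.obj X ≅ X'} (c : M.PushoutCone hE f α) : ShortComplex F :=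
  ⟨biprod.lift f (-c.i), biprod.desc c.g c.k, c.zero⟩

/-- Pushing out along `f` changes the connecting map by the suspension of `f`. This is what matches
the conflation `g, q` with the lower row in the definition of the relative triangulation. -/
lemma connecting_eq {X' : K} {α : M.ϖ.obj X ≅ X'} (c : M.PushoutCone hE f α) :
    M.connecting _ c.conf_q = M.connecting _ c.conf ≫ D.susp.map (M.ϖ.map f) := by
  have := M.naturality c.conf c.conf_q ⟨f, c.k, 𝟙 _, c.sq.w.symm, by simp [c.k_q]⟩
  simpa using this.symm

variable [HasZeroObject K] [HasBinaryBiproducts K]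

/-- The pushout in `F` provides the required homotopy pushout in `K`; the isomorphism `c.e` only
replaces `c.J` and `c.C` by the chosen hull and cosyzygy. -/
lemma exists_basicTriangle (c : M.PushoutCone hE f (Iso.refl (M.ϖ.obj X))) :
    ∃ (Z' : K) (g' : M.ϖ.obj Y ⟶ Z') (k' : hE.hull (M.ϖ.obj X) ⟶ Z')
      (h' : Z' ⟶ hE.cosyzygy (M.ϖ.obj X)),
      IsHomotopyCartesian D (M.ϖ.map f) (hE.ι (M.ϖ.obj X)) g' k' ∧ k' ≫ h' = hE.q (M.ϖ.obj X) ∧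
      D.dist ⟨g', h', hE.δ (M.ϖ.obj X) ≫ D.susp.map (M.ϖ.map f)⟩ := by
  have e₁ := c.e.hom.comm₁
  have e₂ := c.e.hom.comm₂
  have e₃ := c.e.hom.comm₃
  rw [c.e_a] at e₁ e₃
  dsimp only [Iso.refl_hom] at e₁ e₂ e₃
  have e₁' : hE.ι (M.ϖ.obj X) ≫ c.e.inv.b = M.ϖ.map c.i := by
    rw [← Category.id_comp (hE.ι (M.ϖ.obj X)), ← e₁, Category.assoc, Tri.hom_inv_b,
      Category.comp_id]
  rw [D.susp.map_id, Category.comp_id] at e₃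
  refine ⟨M.ϖ.obj c.Z, M.ϖ.map c.g, c.e.inv.b ≫ M.ϖ.map c.k, M.ϖ.map c.q ≫ c.e.hom.c, ?_, ?_, ?_⟩
  · let s : BinaryBicone (M.ϖ.obj Y) (hE.hull (M.ϖ.obj X)) :=
      { pt := M.ϖ.obj (Y ⊞ c.J)
        fst := M.ϖ.map biprod.fst
        snd := M.ϖ.map biprod.snd ≫ c.e.hom.b
        inl := M.ϖ.map biprod.inl
        inr := c.e.inv.b ≫ M.ϖ.map biprod.inr
        inl_fst := by rw [← M.ϖ.map_comp]; simp
        inl_snd := by rw [← M.ϖ.map_comp_assoc]; simp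
        inr_fst := by rw [Category.assoc, ← M.ϖ.map_comp]; simp
        inr_snd := by
          rw [Category.assoc, ← M.ϖ.map_comp_assoc, biprod.inr_snd, M.ϖ.map_id, Category.id_comp]
          exact Tri.inv_hom_b c.e }
    have hs : s.IsBilimit := isBinaryBilimitOfTotal _ (by
      dsimp only [s]
      rw [Category.assoc, ← Category.assoc c.e.hom.b, Tri.hom_inv_b, Category.id_comp,
        ← M.ϖ.map_comp, ← M.ϖ.map_comp, ← M.ϖ.map_add, biprod.total]
      exact M.ϖ.map_id _)
    refine ⟨s, ⟨hs⟩, M.connecting _ c.cone.1, ?_⟩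
    have h₁ : M.ϖ.map f ≫ s.inl - hE.ι (M.ϖ.obj X) ≫ s.inr =
        M.ϖ.map (biprod.lift f (-c.i)) := by
      dsimp only [s]
      rw [reassoc_of% e₁', ← M.ϖ.map_comp, ← M.ϖ.map_comp, ← M.ϖ.map_sub, biprod.lift_eq,
        sub_eq_add_neg, Preadditive.neg_comp]
    have h₂ : s.fst ≫ M.ϖ.map c.g + s.snd ≫ c.e.inv.b ≫ M.ϖ.map c.k =
        M.ϖ.map (biprod.desc c.g c.k) := by
      dsimp only [s]
      rw [Category.assoc, ← Category.assoc c.e.hom.b, Tri.hom_inv_b, Category.id_comp,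
        ← M.ϖ.map_comp, ← M.ϖ.map_comp, ← M.ϖ.map_add, biprod.desc_eq]
    rw [h₁, h₂]
    exact M.dist _ c.cone.1
  · rw [Category.assoc, ← M.ϖ.map_comp_assoc, c.k_q, e₂, ← Category.assoc, Tri.inv_hom_b,
      Category.id_comp]
  · let φ : M.tri _ c.conf_q ⟶ ⟨M.ϖ.map c.g, M.ϖ.map c.q ≫ c.e.hom.c,
        hE.δ (M.ϖ.obj X) ≫ D.susp.map (M.ϖ.map f)⟩ :=
      { a := 𝟙 _
        b := 𝟙 _
        c := c.e.hom.c
        comm₁ := by simp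
        comm₂ := by simp
        comm₃ := by
          dsimp only
          rw [D.susp.map_id, Category.comp_id, c.connecting_eq, e₃, Category.assoc] }
    have : IsIso φ.a := IsIso.id _
    have : IsIso φ.b := IsIso.id _
    have : IsIso φ.c := inferInstanceAs (IsIso c.e.hom.c)
    exact TriangleData.IsFillable.of_iso (Tri.isoOfHom φ) (M.dist _ c.conf_q)

/-- The lower row is determined up to isomorphism by its third map `δ ≫ Σf'`, so it can be
identified with the image of the conflation `g, q`. What remains is that `c.J` vanishes in the
relative stable category and that the last maps agree up to the expected sign. -/
lemma nonempty_iso_basicTriangle {X' Y' Z' : K} {α : M.ϖ.obj X ≅ X'} (c : M.PushoutCone hE f α)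
    (β : M.ϖ.obj Y ≅ Y') {f' : X' ⟶ Y'} {g' : Y' ⟶ Z'} {h' : Z' ⟶ hE.cosyzygy X'}
    (comm : M.ϖ.map f ≫ β.hom = α.hom ≫ f')
    (hd : D.dist ⟨g', h', hE.δ X' ≫ D.susp.map f'⟩) :
    Nonempty (((M.isFrobenius_relativeStructure hE hS).imageTriangle c.seq c.cone).map
      (M.relativeFunctor hE hS) (M.relativeCommSusp hE hS) ≅ hE.basicTriangle f' g' h') := by
  have e₃ := c.e.hom.comm₃
  obtain ⟨z, hz, hz'⟩ := TriangleData.exists_iso_of_h (M.dist _ c.conf_q) hd β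
    ⟨c.e.hom.c, c.e.inv.c, Tri.hom_inv_c c.e, Tri.inv_hom_c c.e⟩ (by
      dsimp only at e₃ ⊢
      rw [c.connecting_eq, Category.assoc, ← D.susp.map_comp, comm, ← reassoc_of% e₃, c.e_a,
        D.susp.map_comp])
  have z₂ := z.hom.comm₂
  have z₁ := z.hom.comm₁
  rw [hz] at z₁
  rw [hz'] at z₂
  dsimp only at z₁ z₂
  obtain ⟨u, hu, hu'⟩ := (M.isFrobenius_relativeStructure hE hS).ext_spec c.cone (𝟙 X)
  obtain ⟨χ, hχ, hχ'⟩ := exists_extHom hE α.hom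
  have hm : E (M.tri _ c.cone.1) := ((M.relativeConflation_iff_mem hE hS _).1 c.cone).2
  -- Two morphisms from the cone triangle to the chosen hull triangle of `X'` are compared: one
  -- through the extension which defines the connecting map in the stable category, one through the
  -- conflation `i, p`. The cone contains `-c.i`, so the second one has to use `-biprod.snd` and
  -- `-c.q`. This is the sign cancelled by `relativeCommSusp`.
  have key := hE.map_c_eq hm (hE.hullTri_mem X') (hE.hull_injective _)
    (M.triMap c.cone.1 ((M.isFrobenius_relativeStructure hE hS).hullSeq_conflation X).1
      ⟨𝟙 X, u, _, hu.symm, hu'.symm⟩ ≫ M.hullComparison hE hS X ≫ χ)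
    (M.triMap c.cone.1 c.conf ⟨𝟙 X, -biprod.snd, -c.q, by simp, by
      dsimp only
      ext
      · simp [c.g_q]
      · simp [c.k_q]⟩ ≫ c.e.hom) (by
      congr 1
      simp [hχ, c.e_a])
  simp only [Tri.comp_c, Functor.map_comp, Functor.map_neg, hχ', Preadditive.neg_comp] at key
  have h₁ : M.ϖ.map (biprod.lift f (-c.i)) ≫ M.ϖ.map biprod.fst ≫ β.hom = α.hom ≫ f' := by
    rw [← M.ϖ.map_comp_assoc, biprod.lift_fst, comm]
  -- The two maps differ by the component on `c.J`, which factors through an `E`-injective, hence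
  -- `E`-projective, object.
  have h₂ : (toRelative E).map (M.ϖ.map (biprod.desc c.g c.k) ≫ z.hom.b) =
      (toRelative E).map ((M.ϖ.map biprod.fst ≫ β.hom) ≫ g') := by
    rw [RelStable.map_eq_iff]
    refine ⟨_, (hE.projective_iff_injective _).2 c.injective, M.ϖ.map biprod.snd,
      M.ϖ.map c.k ≫ z.hom.b, ?_⟩
    rw [Category.assoc, ← z₁, biprod.desc_eq, M.ϖ.map_add, M.ϖ.map_comp, M.ϖ.map_comp,
      Preadditive.add_comp]
    simp
  have h₃ : ((toRelative E).map (M.ϖ.map ((M.isFrobenius_relativeStructure hE hS).ext c.cone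
      (𝟙 X))) ≫ (-(toRelative E).map (M.hullComparison hE hS X).c)) ≫
        (toRelative E).map (hE.ext α.hom) = (toRelative E).map z.hom.b ≫ (toRelative E).map h' := by
    rw [Preadditive.comp_neg, Preadditive.neg_comp, Category.assoc, key, neg_neg, ← Functor.map_comp, ← Functor.map_comp, z₂]
  let φ : ((M.isFrobenius_relativeStructure hE hS).imageTriangle c.seq c.cone).map
      (M.relativeFunctor hE hS) (M.relativeCommSusp hE hS) ⟶ hE.basicTriangle f' g' h' :=
    { a := (toRelative E).map α.hom
      b := (toRelative E).map (M.ϖ.map biprod.fst ≫ β.hom)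
      c := (toRelative E).map z.hom.b
      comm₁ := ((toRelative E).map_comp _ _).symm.trans
        ((congr_arg (toRelative E).map h₁).trans ((toRelative E).map_comp _ _))
      comm₂ := ((toRelative E).map_comp _ _).symm.trans (h₂.trans ((toRelative E).map_comp _ _))
      comm₃ := h₃ }
  have : IsIso φ.a := inferInstanceAs (IsIso ((toRelative E).map α.hom))
  have : IsIso φ.c := inferInstanceAs (IsIso ((toRelative E).map z.hom.b))
  have : IsIso φ.b := by
    have := M.isIso_map_fst (E := E) Y ((hE.projective_iff_injective _).2 c.injective)
    have : IsIso ((toRelative E).map (M.ϖ.map (biprod.fst : Y ⊞ c.J ⟶ Y) ≫ β.hom)) := by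
      rw [Functor.map_comp]
      infer_instance
    exact this
  exact ⟨Tri.isoOfHom φ⟩

end PushoutCone

variable [HasZeroObject K] [HasBinaryBiproducts K] (M hE)

/-- In one direction a distinguished triangle is determined by its first map and can be replaced by
a cone. In the other, the morphism of `K` defining a basic triangle is lifted to `F`, and the
isomorphism with the cone is reflected by the fully faithful comparison functor. -/
lemma relativeData_dist_map_iff
    (T : Tri (M.isFrobenius_relativeStructure hE hS).stableData.susp) :
    (M.isFrobenius_relativeStructure hE hS).stableData.dist T ↔
      hE.relativeData.dist (T.map (M.relativeFunctor hE hS) (M.relativeCommSusp hE hS)) := by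
  constructor
  · intro hT
    obtain @⟨⟨X⟩, ⟨Y⟩, Z, f, g, h⟩ := T
    obtain ⟨f, rfl⟩ := (M.relativeStructure hE hS).toStable.map_surjective f
    obtain ⟨c⟩ := M.nonempty_pushoutCone hE hS f (Iso.refl (M.ϖ.obj X))
    obtain ⟨Z', g', k', h', hsq, hk, hd⟩ := c.exists_basicTriangle
    obtain ⟨e⟩ := c.nonempty_iso_basicTriangle hS (Iso.refl _) (by simp) hd
    have hJ := (M.isProjective_relativeStructure_iff hE hS c.J).2
      ((hE.projective_iff_injective _).2 c.injective)
    have hc : (M.isFrobenius_relativeStructure hE hS).stableData.dist _ :=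
      ⟨c.seq, c.cone, ⟨Iso.refl _⟩⟩
    -- Since `c.J` is projective for the relative structure, the first map of the cone becomes `f`
    -- in the relative stable category.
    obtain ⟨e', -⟩ := TriangleData.exists_iso_of_f hc hT (Iso.refl _)
      ((M.isFrobenius_relativeStructure hE hS).stableModel.biprodFstIso Y hJ)
      (((M.relativeStructure hE hS).toStable.map_comp _ _).symm.trans
        ((congr_arg (M.relativeStructure hE hS).toStable.map (biprod.lift_fst _ _)).trans
          (Category.id_comp _).symm))
    exact ⟨_, _, _, _, g', k', h', hsq, hk, hd,
      ⟨e.symm ≪≫ Tri.mapIso _ (M.relativeCommSusp hE hS) e'⟩⟩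
  · rintro ⟨X', Y', Z', f', g', k', h', -, -, hd, ⟨e⟩⟩
    let α := M.ϖ.objObjPreimageIso X'
    let β := M.ϖ.objObjPreimageIso Y'
    obtain ⟨f, hf⟩ := M.ϖ.map_surjective (α.hom ≫ f' ≫ β.inv)
    obtain ⟨c⟩ := M.nonempty_pushoutCone hE hS f α
    obtain ⟨e'⟩ := c.nonempty_iso_basicTriangle hS β (by rw [hf]; simp) hd
    exact ⟨c.seq, c.cone, ⟨Tri.preimageIso _ (M.relativeCommSusp hE hS) (e' ≪≫ e)⟩⟩

/-- The relative stable category is equivalent to the stable category of the exact structure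
given by the class of triangles. -/
noncomputable def relativeEquiv :
    TriangleEquiv (M.isFrobenius_relativeStructure hE hS).stableData hE.relativeData where
  functor := M.relativeFunctor hE hS
  isEquivalence := {}
  commSusp := M.relativeCommSusp hE hS
  dist_iff := M.relativeData_dist_map_iff hE hS

end StableModel

end RelStable

/-! ### Inverting an equivalence of triangulated categories. -/

namespace RelStable

namespace TriangleEquiv

variable {C : Type u} [Category.{v} C] {C' : Type u'} [Category.{v'} C'] {D : TriangleData C}
  {D' : TriangleData C'} (G : TriangleEquiv D D')

/-- The inverse functor. -/
noncomputable def inverse : C' ⥤ C :=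
  have := G.isEquivalence
  G.functor.inv

/-- The counit of an equivalence of triangulated categories. -/
noncomputable def counit (Y : C') : G.functor.obj (G.inverse.obj Y) ≅ Y :=
  have := G.isEquivalence
  G.functor.asEquivalence.counitIso.app Y

lemma counit_naturality {X Y : C'} (f : X ⟶ Y) :
    G.functor.map (G.inverse.map f) ≫ (G.counit Y).hom = (G.counit X).hom ≫ f :=
  have := G.isEquivalence
  G.functor.asEquivalence.counitIso.hom.naturality f

lemma commSusp_naturality {X Y : C} (f : X ⟶ Y) :
    G.functor.map (D.susp.map f) ≫ G.commSusp.hom.app Y =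
      G.commSusp.hom.app X ≫ D'.susp.map (G.functor.map f) :=
  G.commSusp.hom.naturality f

/-- The commutation of the inverse with the suspensions, on objects. -/
noncomputable def inverseCommSuspApp (Y : C') :
    G.inverse.obj (D'.susp.obj Y) ≅ D.susp.obj (G.inverse.obj Y) :=
  have := G.isEquivalence
  G.functor.preimageIso (G.counit (D'.susp.obj Y) ≪≫ D'.susp.mapIso (G.counit Y).symm ≪≫
    (G.commSusp.app (G.inverse.obj Y)).symm)

/-- The commutation isomorphism of the inverse is chosen to make this true: the counit is compatible
with suspensions, which is the last square of `mapMapIso`. -/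
lemma map_inverseCommSuspApp_hom (Y : C') :
    G.functor.map (G.inverseCommSuspApp Y).hom ≫ G.commSusp.hom.app (G.inverse.obj Y) ≫
      D'.susp.map (G.counit Y).hom = (G.counit (D'.susp.obj Y)).hom := by
  have := G.isEquivalence
  have h : G.functor.map (G.inverseCommSuspApp Y).hom = (G.counit (D'.susp.obj Y)).hom ≫
      D'.susp.map (G.counit Y).inv ≫ (G.commSusp.app (G.inverse.obj Y)).inv :=
    G.functor.map_preimage _
  have h' : (G.commSusp.app (G.inverse.obj Y)).inv ≫ G.commSusp.hom.app (G.inverse.obj Y) = 𝟙 _ :=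
    (G.commSusp.app (G.inverse.obj Y)).inv_hom_id
  rw [h, Category.assoc, Category.assoc, reassoc_of% h', ← D'.susp.map_comp, Iso.inv_hom_id,
    D'.susp.map_id, Category.comp_id]

/-- The commutation of the inverse of an equivalence of triangulated categories with the
suspensions. -/
noncomputable def inverseCommSusp : D'.susp ⋙ G.inverse ≅ G.inverse ⋙ D.susp :=
  NatIso.ofComponents G.inverseCommSuspApp (fun {X Y} f => by
    have := G.isEquivalence
    have : IsIso (G.commSusp.hom.app (G.inverse.obj Y)) := inferInstance
    refine G.functor.map_injective ?_
    change G.functor.map (G.inverse.map (D'.susp.map f) ≫ (G.inverseCommSuspApp Y).hom) =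
      G.functor.map ((G.inverseCommSuspApp X).hom ≫ D.susp.map (G.inverse.map f))
    have hY := G.map_inverseCommSuspApp_hom Y
    rw [← cancel_mono (G.commSusp.hom.app (G.inverse.obj Y)),
      ← cancel_mono (D'.susp.map (G.counit Y).hom)]
    simp only [G.functor.map_comp, Category.assoc]
    rw [hY, counit_naturality, reassoc_of% (G.commSusp_naturality (G.inverse.map f)), ← D'.susp.map_comp, counit_naturality,
      D'.susp.map_comp, ← G.map_inverseCommSuspApp_hom X]
    simp only [Category.assoc])

/-- The image of a triangle under the inverse and the equivalence is isomorphic to the triangle. -/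
noncomputable def mapMapIso (T : Tri D'.susp) :
    (T.map G.inverse G.inverseCommSusp).map G.functor G.commSusp ≅ T :=
  let φ : (T.map G.inverse G.inverseCommSusp).map G.functor G.commSusp ⟶ T :=
    { a := (G.counit T.X).hom
      b := (G.counit T.Y).hom
      c := (G.counit T.Z).hom
      comm₁ := G.counit_naturality T.f
      comm₂ := G.counit_naturality T.g
      comm₃ := by
        change (G.functor.map (G.inverse.map T.h ≫ (G.inverseCommSuspApp T.X).hom) ≫
          G.commSusp.hom.app (G.inverse.obj T.X)) ≫ D'.susp.map (G.counit T.X).hom = _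
        rw [G.functor.map_comp, Category.assoc, Category.assoc, map_inverseCommSuspApp_hom,
          counit_naturality]
        rfl }
  have : IsIso φ.a := inferInstanceAs (IsIso (G.counit T.X).hom)
  have : IsIso φ.b := inferInstanceAs (IsIso (G.counit T.Y).hom)
  have : IsIso φ.c := inferInstanceAs (IsIso (G.counit T.Z).hom)
  Tri.isoOfHom φ

/-- The inverse of an equivalence of triangulated categories. -/
noncomputable def symm (hD : ∀ {T T' : Tri D'.susp}, (T ≅ T') → D'.dist T → D'.dist T') :
    TriangleEquiv D' D where
  functor := G.inverse
  isEquivalence := by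
    have := G.isEquivalence
    exact inferInstanceAs G.functor.inv.IsEquivalence
  commSusp := G.inverseCommSusp
  dist_iff T := by
    rw [G.dist_iff]
    exact ⟨hD (G.mapMapIso T).symm, hD (G.mapMapIso T)⟩

end TriangleEquiv

end RelStable

theorem mainTheorem2 :
    (∀ (F : Type u) [Category.{v} F] [Preadditive F] [HasZeroObject F] [HasBinaryBiproducts F]
        (S : ExactStructure F) (hS : S.IsFrobenius) (E : Tri hS.stableData.susp → Prop)
        (hE : IsFrobeniusClass hS.stableData E),
      ∃ S' : ExactStructure F,
        (∀ T : ShortComplex F, S'.conflation T ↔ inducedConflation hS E T) ∧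
        (∀ Q : F, S'.IsProjective Q ↔ IsEProjective E (S.toStable.obj Q)) ∧
        (∀ Q : F, S'.IsInjective Q ↔ IsEInjective E (S.toStable.obj Q)) ∧
        ∃ (hS' : S'.IsFrobenius) (Φ : TriangleEquiv hS'.stableData hE.relativeData),
          Nonempty (S'.toStable ⋙ Φ.functor ≅ S.toStable ⋙ toRelative E)) ∧
    (∀ (K : Type u) [Category.{v} K] [Preadditive K] [HasZeroObject K] [HasShift K ℤ]
        [∀ n : ℤ, (shiftFunctor K n).Additive] [Pretriangulated K] [IsTriangulated K],
      IsAlgebraicTriangulation.{v, u, v', u'} (ofPretriangulated K) →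
      ∀ (E : Tri (ofPretriangulated K).susp → Prop)
        (hE : IsFrobeniusClass (ofPretriangulated K) E),
        IsAlgebraicTriangulation.{v, u, v', u'} hE.relativeData) := by
  refine ⟨?_, ?_⟩
  · intro F _ _ _ _ S hS E hE
    -- For the quotient functor itself, `tri` is the image triangle by definition, and the
    -- comparison functor commutes strictly with the two quotient functors.
    exact ⟨hS.stableModel.relativeStructure hE hS,
      hS.stableModel.relativeConflation_iff_mem hE hS,
      hS.stableModel.isProjective_relativeStructure_iff hE hS,
      hS.stableModel.isInjective_relativeStructure_iff hE hS,
      hS.stableModel.isFrobenius_relativeStructure hE hS,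
      hS.stableModel.relativeEquiv hE hS, ⟨Iso.refl _⟩⟩
  · rintro K _ _ _ _ _ _ _ ⟨F, _, _, _, _, S, hS, ⟨G⟩⟩ E hE
    -- Algebraicity gives an equivalence from `K` to a stable category; its inverse makes `K` the
    -- target of a stable model of the same `F`, on which the class `E` induces a new exact
    -- structure.
    let M := StableModel.ofEquiv (G.symm TriangleData.IsFillable.of_iso)
    exact ⟨F, _, _, _, _, M.relativeStructure hE hS, M.isFrobenius_relativeStructure hE hS,
      ⟨(M.relativeEquiv hE hS).symm hE.relativeData_dist_of_iso⟩⟩
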